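/- Let $\mathbb M_2$ be the algebra of complex $2\times2$ matrices and let $\mathbb E_2$ be the set of all $A\in\mathbb M_2$ such that $A$ and $I-A$ are positive semidefinite, with the topology inherited from $\mathbb M_2$. Let $\phi:\mathbb E_2\to\mathbb E_2$ be a continuous sequential endomorphism, i.e. a continuous map with $$\phi(A^{1/2}BA^{1/2})=\phi(A)^{1/2}\phi(B)\phi(A)^{1/2}\qquad(A,B\in\mathbb E_2).$$ If $\phi$ is unital, i.e. $\phi(I)=I$, then $\phi$ has one of the following four forms: (d1) there exist a unitary $U\in\mathbb M_2$ and a real number $c\ge 0$ such that $\phi(A)=(\det A)^c\,UAU^*$ for all $A\in\mathbb E_2$; (d2) there exists a unitary $V\in\mathbb M_2$ such that $\phi(A)=V(\operatorname{adj}A)V^*$ for all $A\in\mathbb E_2$, where $\operatorname{adj}A$ is the adjugate of $A$; (d3) there exist a unitary $V\in\mathbb M_2$ and a real number $d>1$ such that $\phi(A)=(\det A)^d\,VA^{-1}V^*$ for all invertible $A\in\mathbb E_2$, and $\phi(A)=0$ for all non-invertible $A\in\mathbb E_2$; (d4) there exist a unitary $W\in\mathbb M_2$ and real numbers $c_1,c_2\ge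 0$ such that $\phi(A)=W\,\mathrm{Diag}[(\det A)^{c_1},(\det A)^{c_2}]\,W^*$ for all $A\in\mathbb E_2$. If $\phi(I)\ne I$, then either there exist a unitary $W\in\mathbb M_2$ and a real number $c\ge 0$ such that $\phi(A)=W\,\mathrm{Diag}[(\det A)^{c},0]\,W^*$ for all $A\in\mathbb E_2$, or $\phi(A)=0$ for all $A\in\mathbb E_2$. Throughout, $0^0=1$. -/

import Mathlib

open Matrix

namespace SeqEffect

section
open scoped ComplexOrder MatrixOrder

/-- The set of `n × n` effects: complex matrices `A` with `0 ≤ A ≤ I` in the Loewner order. -/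
def effects (n : ℕ) : Set (Matrix (Fin n) (Fin n) ℂ) :=
  {A | A.PosSemidef ∧ (1 - A).PosSemidef}

/-- The `n × n` effect algebra, with the topology inherited from the matrices. -/
abbrev Effect (n : ℕ) : Type := ↥(effects n)

/-- The identity matrix as an effect. -/
instance instOneEffect (n : ℕ) : One (Effect n) :=
  ⟨⟨1, Matrix.PosSemidef.one, by rw [sub_self]; exact Matrix.PosSemidef.zero⟩⟩

/-- The positive semidefinite square root of a matrix (used for positive semidefinite matrices). -/
noncomputable def msqrt {n : ℕ} (A : Matrix (Fin n) (Fin n) ℂ) : Matrix (Fin n) (Fin n) ℂ :=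
  CFC.sqrt A

theorem msqrt_posSemidef {n : ℕ} (A : Matrix (Fin n) (Fin n) ℂ) : (msqrt A).PosSemidef :=
  (CFC.sqrt_nonneg A).posSemidef

theorem msqrt_mul_msqrt {n : ℕ} {A : Matrix (Fin n) (Fin n) ℂ} (hA : A.PosSemidef) :
    msqrt A * msqrt A = A :=
  CFC.sqrt_mul_sqrt_self A hA.nonneg

theorem seqProd_mem {n : ℕ} {A B : Matrix (Fin n) (Fin n) ℂ} (hA : A ∈ effects n)
    (hB : B ∈ effects n) : msqrt A * B * msqrt A ∈ effects n := by
  have hs : (msqrt A)ᴴ = msqrt A := (msqrt_posSemidef A).isHermitian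
  have key : ∀ C : Matrix (Fin n) (Fin n) ℂ, C.PosSemidef →
      (msqrt A * C * msqrt A).PosSemidef := by
    intro C hC
    have h := hC.mul_mul_conjTranspose_same (msqrt A)
    rwa [hs] at h
  refine ⟨key B hB.1, ?_⟩
  have h2 : (1 : Matrix (Fin n) (Fin n) ℂ) - msqrt A * B * msqrt A
      = (1 - A) + msqrt A * (1 - B) * msqrt A := by
    rw [mul_sub, sub_mul, mul_one, msqrt_mul_msqrt hA.1]
    abel
  rw [h2]
  exact hA.2.add (key _ hB.2)

end

/-- The sequential product `A ∘ B = A^{1/2} B A^{1/2}` of effects. -/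
noncomputable def seqProd {n : ℕ} (A B : Effect n) : Effect n :=
  ⟨msqrt A.1 * B.1 * msqrt A.1, seqProd_mem A.2 B.2⟩

/-- Sequential endomorphisms of the effect algebra. -/
def IsSeqEndo {n : ℕ} (φ : Effect n → Effect n) : Prop :=
  ∀ A B : Effect n, φ (seqProd A B) = seqProd (φ A) (φ B)

/-- The determinant of an effect as a real number (it lies in `[0, 1]`). -/
noncomputable def rdet {n : ℕ} (A : Effect n) : ℝ := (A.1.det).re

/-- `A ↦ (det A)^c U A U*` with `U` unitary, `c ≥ 0` (and `0 ^ 0 = 1`). -/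
def FormConj (φ : Effect 2 → Effect 2) : Prop :=
  ∃ U ∈ Matrix.unitaryGroup (Fin 2) ℂ, ∃ c : ℝ, 0 ≤ c ∧
    ∀ A : Effect 2, (φ A).1 = (rdet A ^ c) • (U * A.1 * Uᴴ)

/-- `A ↦ V (adj A) V*` with `V` unitary. -/
def FormAdj (φ : Effect 2 → Effect 2) : Prop :=
  ∃ V ∈ Matrix.unitaryGroup (Fin 2) ℂ, ∀ A : Effect 2, (φ A).1 = V * A.1.adjugate * Vᴴ

/-- `A ↦ (det A)^d V A⁻¹ V*` for invertible `A`, and `A ↦ 0` otherwise, with `V` unitary, `d > 1`. -/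
def FormInv (φ : Effect 2 → Effect 2) : Prop :=
  ∃ V ∈ Matrix.unitaryGroup (Fin 2) ℂ, ∃ d : ℝ, 1 < d ∧
    ∀ A : Effect 2, (IsUnit A.1 → (φ A).1 = (rdet A ^ d) • (V * A.1⁻¹ * Vᴴ)) ∧
      (¬ IsUnit A.1 → (φ A).1 = 0)

/-- `A ↦ W Diag[(det A)^c₁, (det A)^c₂] W*` with `W` unitary, `c₁, c₂ ≥ 0` (and `0 ^ 0 = 1`). -/
def FormDiag (φ : Effect 2 → Effect 2) : Prop :=
  ∃ W ∈ Matrix.unitaryGroup (Fin 2) ℂ, ∃ c₁ c₂ : ℝ, 0 ≤ c₁ ∧ 0 ≤ c₂ ∧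
    ∀ A : Effect 2, (φ A).1 =
      W * Matrix.diagonal ![((rdet A ^ c₁ : ℝ) : ℂ), ((rdet A ^ c₂ : ℝ) : ℂ)] * Wᴴ

/-- `A ↦ W Diag[(det A)^c, 0] W*` with `W` unitary, `c ≥ 0` (and `0 ^ 0 = 1`). -/
def FormDiagZero (φ : Effect 2 → Effect 2) : Prop :=
  ∃ W ∈ Matrix.unitaryGroup (Fin 2) ℂ, ∃ c : ℝ, 0 ≤ c ∧
    ∀ A : Effect 2, (φ A).1 = W * Matrix.diagonal ![((rdet A ^ c : ℝ) : ℂ), 0] * Wᴴ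

end SeqEffect

/-! The proof reads an endomorphism `Φ` off the one-parameter semigroups
`damp P x = P + exp (-x) (1 - P)`, `P` a rank one projection, and the scalars `exp (-x)`. Every
invertible effect is a scalar times some `damp P x`, and invertible effects are dense
(`eqOn_effects_of_invertible`).

`Φ` preserves Jordan triple products `A B A` and, since positive `a`, `b` with
`a b² a = b a² b` commute (`commute_of_mul_mul_eq`, from the Fuglede–Putnam theorem), products of
commuting effects. Hence semigroups go to semigroups: if `Φ` is unital, `Φ (damp P x)` has
eigenvalues `exp (-α x)`, `exp (-β x)` on a projection `R P` and its complement, with `α ≤ β`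
(`exists_spec_exp`).

Compressing `damp Q (2 x)` by `damp P x` yields, as `x → ∞`, a matrix `m • damp S y` with
`m → tr (P Q)`, `S → P` and a known determinant (`exists_compression`). Comparing logarithms
shows that the decay rate of any submultiplicative homogeneous function does not depend on `P`
(`decay_rate_const`). Applied to a multiplicative functional, this shows it to be a power of the
determinant (`functional_eq_rpow_det`); this settles the case of `Φ 1` of rank one, and the case
where some `Φ (t • 1)` is not scalar, for then `Φ` is diagonal in a fixed basis.

When all `Φ (t • 1)` are scalar, decay rates of the norm and of the determinant of `Φ` show that
`α` and `β` are constant. If `α = β`, `Φ` is `det ^ α`. Otherwise the same compression gives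
`tr (R P R Q) = tr (P Q) ^ (β - α)` (`IsSeqEndoOn.trace_mul_eq_rpow`). Since
`R (1 - P) = 1 - R P`, evaluating at transition probability `1 / 2` forces `β - α = 1`, so `R` is a
symmetry of transition probabilities. By Wigner's theorem (`exists_unitary_of_symmetry`) it is
`P ↦ U P U*` or `P ↦ U (1 - P) U*`, and `Φ A` is `det A ^ α` times `U A U*` or `U (adj A) U*`. -/

open Matrix
namespace SeqEffect
open scoped ComplexOrder MatrixOrder Matrix.Norms.L2Operator
open Filter Topology

/-! ### Rank one projections and spectral decompositions of `2 × 2` matrices -/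

/-- The algebra of complex `2 × 2` matrices. -/
abbrev M2 : Type := Matrix (Fin 2) (Fin 2) ℂ

/-- Orthogonal projections of rank one in `M2`. -/
structure IsRankOneProj (P : M2) : Prop where
  herm : Pᴴ = P
  idem : P * P = P
  trace_eq : P.trace = 1

/-- The matrix with eigenvalue `a` on the range of the projection `R` and `b` on its orthogonal
complement. -/
noncomputable def spec (R : M2) (a b : ℝ) : M2 := a • R + b • (1 - R)

theorem spec_self (R : M2) (a : ℝ) : spec R a a = a • (1 : M2) := by
  rw [spec, ← smul_add]; simp

theorem spec_one_one (R : M2) : spec R 1 1 = 1 := by rw [spec_self, one_smul]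

theorem spec_one_zero (R : M2) : spec R 1 0 = R := by simp [spec]

theorem spec_compl (R : M2) (a b : ℝ) : spec (1 - R) a b = spec R b a := by
  rw [spec, spec, sub_sub_cancel, add_comm]

theorem smul_spec (R : M2) (c a b : ℝ) : c • spec R a b = spec R (c * a) (c * b) := by
  simp only [spec, smul_add, smul_smul]

theorem one_sub_spec (R : M2) (a b : ℝ) : 1 - spec R a b = spec R (1 - a) (1 - b) := by
  simp only [spec, sub_smul, one_smul, smul_sub]; abel

theorem spec_add (R : M2) (a b c d : ℝ) :
    spec R a b + spec R c d = spec R (a + c) (b + d) := by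
  simp only [spec, add_smul]; abel

/-- The polarized Cayley–Hamilton theorem in `M2`, giving `R X R = tr (R X) R` for singular `R`. -/
theorem mul_mul_self_eq (R X : M2) :
    R * X * R = (R * X).trace • R - R.det • X.adjugate := by
  rw [det_fin_two, adjugate_fin_two]
  ext i j
  fin_cases i <;> fin_cases j <;>
    simp [Matrix.mul_apply, Matrix.trace, Fin.sum_univ_two] <;> ring

/-- `U Diag[a, b] U*` for real `a`, `b`. -/
noncomputable def conjDiag (U : M2) (a b : ℝ) : M2 :=
  U * Matrix.diagonal ![(a : ℂ), (b : ℂ)] * Uᴴ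

theorem conjDiag_add (U : M2) (a b c d : ℝ) :
    conjDiag U a b + conjDiag U c d = conjDiag U (a + c) (b + d) := by
  rw [conjDiag, conjDiag, conjDiag, ← add_mul, ← mul_add, diagonal_add]
  congr 3; ext i; fin_cases i <;> simp

theorem smul_conjDiag (U : M2) (a b c : ℝ) :
    c • conjDiag U a b = conjDiag U (c * a) (c * b) := by
  rw [conjDiag, conjDiag, ← smul_mul_assoc, ← mul_smul_comm, ← diagonal_smul]
  congr 3; ext i; fin_cases i <;> simp

theorem conjDiag_one {U : M2} (hU : U ∈ Matrix.unitaryGroup (Fin 2) ℂ) : conjDiag U 1 1 = 1 := by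
  have : Matrix.diagonal ![((1 : ℝ) : ℂ), ((1 : ℝ) : ℂ)] = (1 : M2) := by
    rw [← diagonal_one]; congr 1; ext i; fin_cases i <;> simp
  rw [conjDiag, this, mul_one]
  exact Matrix.mem_unitaryGroup_iff.1 hU

theorem conjDiag_mul {U : M2} (hU : U ∈ Matrix.unitaryGroup (Fin 2) ℂ) (a b c d : ℝ) :
    conjDiag U a b * conjDiag U c d = conjDiag U (a * c) (b * d) := by
  have h : Uᴴ * U = 1 := Matrix.mem_unitaryGroup_iff'.1 hU
  have e : Matrix.diagonal ![((a * c : ℝ) : ℂ), ((b * d : ℝ) : ℂ)]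
      = Matrix.diagonal ![(a : ℂ), (b : ℂ)] * Matrix.diagonal ![(c : ℂ), (d : ℂ)] := by
    rw [diagonal_mul_diagonal]; congr 1; ext i; fin_cases i <;> simp
  simp only [conjDiag, e]
  calc _ = U * diagonal ![(a : ℂ), (b : ℂ)] * (Uᴴ * U) * diagonal ![(c : ℂ), (d : ℂ)] * Uᴴ := by
        simp only [mul_assoc]
    _ = _ := by rw [h, mul_one]; simp only [mul_assoc]

theorem conjDiag_conjTranspose (U : M2) (a b : ℝ) : (conjDiag U a b)ᴴ = conjDiag U a b := by
  rw [conjDiag, conjTranspose_mul, conjTranspose_mul, conjTranspose_conjTranspose,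
    diagonal_conjTranspose, mul_assoc]
  congr 3; ext i; fin_cases i <;> simp

theorem trace_conjDiag {U : M2} (hU : U ∈ Matrix.unitaryGroup (Fin 2) ℂ) (a b : ℝ) :
    (conjDiag U a b).trace = a + b := by
  rw [conjDiag, trace_mul_comm, ← mul_assoc,
    show Uᴴ * U = 1 from Matrix.mem_unitaryGroup_iff'.1 hU, one_mul]
  simp [Matrix.trace, Fin.sum_univ_two]

theorem det_conjDiag {U : M2} (hU : U ∈ Matrix.unitaryGroup (Fin 2) ℂ) (a b : ℝ) :
    (conjDiag U a b).det = a * b := by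
  rw [conjDiag, det_mul_comm, ← mul_assoc,
    show Uᴴ * U = 1 from Matrix.mem_unitaryGroup_iff'.1 hU, one_mul]
  simp [Fin.prod_univ_two]

theorem isRankOneProj_conjDiag {U : M2} (hU : U ∈ Matrix.unitaryGroup (Fin 2) ℂ) :
    IsRankOneProj (conjDiag U 1 0) :=
  ⟨conjDiag_conjTranspose U 1 0, by rw [conjDiag_mul hU]; simp, by rw [trace_conjDiag hU]; simp⟩

theorem spec_conjDiag {U : M2} (hU : U ∈ Matrix.unitaryGroup (Fin 2) ℂ) (a b : ℝ) :
    spec (conjDiag U 1 0) a b = conjDiag U a b := by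
  have h : (1 : M2) - conjDiag U 1 0 = conjDiag U 0 1 := by
    rw [← conjDiag_one hU, sub_eq_iff_eq_add, conjDiag_add]; simp
  rw [spec, h, smul_conjDiag, smul_conjDiag, conjDiag_add]; simp

theorem exists_conjDiag {H : M2} (hH : H.IsHermitian) :
    ∃ U ∈ Matrix.unitaryGroup (Fin 2) ℂ, ∃ a b : ℝ, H = conjDiag U a b := by
  refine ⟨hH.eigenvectorUnitary, hH.eigenvectorUnitary.2, hH.eigenvalues 0, hH.eigenvalues 1, ?_⟩
  conv_lhs => rw [hH.spectral_theorem]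
  rw [Unitary.conjStarAlgAut_apply, conjDiag]
  congr 3
  ext i; fin_cases i <;> simp

namespace IsRankOneProj
variable {P R : M2}

theorem compl (h : IsRankOneProj P) : IsRankOneProj (1 - P) where
  herm := by rw [conjTranspose_sub, h.herm, conjTranspose_one]
  idem := by rw [sub_mul, mul_sub, mul_sub, h.idem]; simp
  trace_eq := by rw [trace_sub, h.trace_eq]; norm_num

theorem det_eq_zero (h : IsRankOneProj P) : P.det = 0 := by
  have h1 : P * P = P := h.idem
  have h2 := h.trace_eq
  rw [Matrix.trace_fin_two] at h2
  have e := congrFun (congrFun h1 0) 0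
  simp only [Matrix.mul_apply, Fin.sum_univ_two] at e
  rw [det_fin_two]
  linear_combination -e + P 0 0 * h2

theorem mul_mul_self (h : IsRankOneProj P) (X : M2) : P * X * P = (P * X).trace • P := by
  rw [mul_mul_self_eq, h.det_eq_zero, zero_smul, sub_zero]

/-- Every rank one projection is unitarily equivalent to `Diag[1, 0]`. -/
theorem exists_unitary (h : IsRankOneProj R) :
    ∃ U ∈ Matrix.unitaryGroup (Fin 2) ℂ, R = conjDiag U 1 0 := by
  obtain ⟨U, hU, a, b, rfl⟩ := exists_conjDiag (H := R) h.herm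
  have h1 := h.trace_eq
  have h2 := h.det_eq_zero
  rw [trace_conjDiag hU] at h1
  rw [det_conjDiag hU] at h2
  norm_cast at h1 h2
  rcases mul_eq_zero.1 h2 with h0 | h0
  · obtain rfl : b = 1 := by linarith
    subst h0
    refine ⟨U * !![0, 1; 1, 0], mul_mem hU ?_, ?_⟩
    · rw [Matrix.mem_unitaryGroup_iff]
      ext i j; fin_cases i <;> fin_cases j <;> simp [Matrix.mul_apply, star_eq_conjTranspose]
    · rw [conjDiag, conjDiag, conjTranspose_mul]
      have : diagonal ![((0:ℝ) : ℂ), ((1:ℝ):ℂ)] = !![0, 1; 1, 0] *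
          diagonal ![((1:ℝ) : ℂ), ((0:ℝ):ℂ)] * (!![0, 1; 1, 0] : M2)ᴴ := by
        ext i j; fin_cases i <;> fin_cases j <;> simp [Matrix.mul_apply, vecMul_diagonal]
      rw [this]; simp only [mul_assoc]
  · subst h0
    obtain rfl : a = 1 := by linarith
    exact ⟨U, hU, rfl⟩

theorem spec_mul (h : IsRankOneProj R) (a b c d : ℝ) :
    spec R a b * spec R c d = spec R (a * c) (b * d) := by
  obtain ⟨U, hU, rfl⟩ := h.exists_unitary
  simp only [spec_conjDiag hU, conjDiag_mul hU]

theorem trace_spec (h : IsRankOneProj R) (a b : ℝ) : (spec R a b).trace = a + b := by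
  obtain ⟨U, hU, rfl⟩ := h.exists_unitary
  rw [spec_conjDiag hU, trace_conjDiag hU]

theorem det_spec (h : IsRankOneProj R) (a b : ℝ) : (spec R a b).det = a * b := by
  obtain ⟨U, hU, rfl⟩ := h.exists_unitary
  rw [spec_conjDiag hU, det_conjDiag hU]

theorem mul_spec (h : IsRankOneProj R) (a b : ℝ) : R * spec R a b = a • R := by
  have := h.spec_mul 1 0 a b
  rw [spec_one_zero] at this
  rw [this]; simp [spec]

theorem trace_mul_spec (h : IsRankOneProj R) (a b : ℝ) : (R * spec R a b).trace = a := by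
  rw [h.mul_spec, trace_smul, h.trace_eq]; simp

theorem posSemidef (h : IsRankOneProj R) : R.PosSemidef := by
  have := posSemidef_conjTranspose_mul_self R
  rwa [h.herm, h.idem] at this

theorem trace_mul_nonneg (h : IsRankOneProj R) {A : M2} (hA : A.PosSemidef) :
    0 ≤ (R * A).trace := by
  have := (hA.mul_mul_conjTranspose_same R).trace_nonneg
  rwa [h.herm, Matrix.trace_mul_comm, ← mul_assoc, h.idem] at this

theorem posSemidef_spec (h : IsRankOneProj R) {a b : ℝ} (ha : 0 ≤ a) (hb : 0 ≤ b) :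
    (spec R a b).PosSemidef :=
  (h.posSemidef.smul ha).add (h.compl.posSemidef.smul hb)

theorem posSemidef_spec_iff (h : IsRankOneProj R) {a b : ℝ} :
    (spec R a b).PosSemidef ↔ 0 ≤ a ∧ 0 ≤ b := by
  refine ⟨fun H => ⟨?_, ?_⟩, fun H => h.posSemidef_spec H.1 H.2⟩
  · have := h.trace_mul_nonneg H
    rw [h.trace_mul_spec] at this
    exact_mod_cast this
  · have := h.compl.trace_mul_nonneg H
    rw [← spec_compl, h.compl.trace_mul_spec] at this
    exact_mod_cast this

theorem spec_mem_effects_iff (h : IsRankOneProj R) {a b : ℝ} :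
    spec R a b ∈ effects 2 ↔ (0 ≤ a ∧ a ≤ 1) ∧ 0 ≤ b ∧ b ≤ 1 := by
  change (spec R a b).PosSemidef ∧ (1 - spec R a b).PosSemidef ↔ _
  rw [one_sub_spec, h.posSemidef_spec_iff, h.posSemidef_spec_iff]
  constructor
  · rintro ⟨⟨_, _⟩, _, _⟩; refine ⟨⟨?_, ?_⟩, ?_, ?_⟩ <;> linarith
  · rintro ⟨⟨_, _⟩, _, _⟩; refine ⟨⟨?_, ?_⟩, ?_, ?_⟩ <;> linarith

theorem spec_inj (h : IsRankOneProj R) {a b c d : ℝ} (H : spec R a b = spec R c d) :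
    a = c ∧ b = d := by
  have h1 := h.trace_mul_spec a b
  have h2 := h.compl.trace_mul_spec b a
  rw [H, h.trace_mul_spec] at h1
  rw [spec_compl, H, ← spec_compl, h.compl.trace_mul_spec] at h2
  exact ⟨by exact_mod_cast h1.symm, by exact_mod_cast h2.symm⟩

/-- A Hermitian matrix commuting with a rank one projection is diagonal with respect to it. -/
theorem eq_spec_of_commute (h : IsRankOneProj R) {X : M2} (hX : X.IsHermitian)
    (hc : R * X = X * R) :
    X = spec R (R * X).trace.re ((1 - R) * X).trace.re := by
  have key : ∀ {Q : M2}, IsRankOneProj Q → Q * X = X * Q → ((Q * X).trace.re : ℝ) • Q = Q * X := by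
    intro Q hQ hQX
    have h1 : Q * X = (Q * X).trace • Q := by
      rw [← hQ.mul_mul_self, mul_assoc, ← hQX, ← mul_assoc, hQ.idem]
    have h2 : ((Q * X).trace.re : ℂ) = (Q * X).trace := by
      rw [← Complex.conj_eq_iff_re, starRingEnd_apply, ← trace_conjTranspose, conjTranspose_mul,
        hX.eq, hQ.herm, trace_mul_comm]
    conv_rhs => rw [h1, ← h2]
    ext i j; simp
  rw [spec, key h hc, key h.compl (by rw [sub_mul, mul_sub, hc, one_mul, mul_one]), sub_mul]
  simp

end IsRankOneProj

/-- Spectral decomposition of a Hermitian `2 × 2` matrix. -/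
theorem exists_spec {H : M2} (hH : H.IsHermitian) :
    ∃ R, IsRankOneProj R ∧ ∃ a b : ℝ, b ≤ a ∧ H = spec R a b := by
  obtain ⟨U, hU, a, b, rfl⟩ := exists_conjDiag hH
  have hR := isRankOneProj_conjDiag hU
  rcases le_total b a with h | h
  · exact ⟨_, hR, a, b, h, (spec_conjDiag hU a b).symm⟩
  · exact ⟨_, hR.compl, b, a, h, by rw [spec_compl, spec_conjDiag hU]⟩

theorem IsRankOneProj.norm_spec {R : M2} (h : IsRankOneProj R) {a b : ℝ} (hb : 0 ≤ b)
    (hab : b ≤ a) : ‖spec R a b‖ = a := by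
  obtain ⟨U, hU, rfl⟩ := h.exists_unitary
  rw [spec_conjDiag hU, conjDiag, ← star_eq_conjTranspose,
    CStarRing.norm_mul_mem_unitary _ (Unitary.star_mem hU), CStarRing.norm_mem_unitary_mul _ hU,
    l2_opNorm_diagonal]
  apply le_antisymm
  · rw [pi_norm_le_iff_of_nonneg (hb.trans hab)]
    intro i; fin_cases i <;> simp [abs_of_nonneg, hb, hab, hb.trans hab]
  · simpa [abs_of_nonneg (hb.trans hab)] using norm_le_pi_norm ![(a : ℂ), (b : ℂ)] 0

/-! ### Sequential endomorphisms as Jordan triple maps -/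

theorem msqrt_mul_self {A : M2} (hA : A.PosSemidef) : msqrt (A * A) = A :=
  CFC.sqrt_mul_self A hA.nonneg

theorem effects_mul_self {A : M2} (hA : A ∈ effects 2) : A * A ∈ effects 2 := by
  have h := seqProd_mem hA hA
  have e : msqrt A * A * msqrt A = A * A := by
    conv_lhs => enter [1, 2]; rw [← msqrt_mul_msqrt hA.1]
    conv_rhs => rw [← msqrt_mul_msqrt hA.1]
    simp only [mul_assoc]
  rwa [e] at h

theorem effects_mul_mul {A B : M2} (hA : A ∈ effects 2) (hB : B ∈ effects 2) :
    A * B * A ∈ effects 2 := by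
  have h := seqProd_mem (effects_mul_self hA) hB
  rwa [msqrt_mul_self hA.1] at h

theorem one_mem_effects : (1 : M2) ∈ effects 2 := (1 : Effect 2).2

theorem exists_spec_of_mem_effects {A : M2} (hA : A ∈ effects 2) :
    ∃ R, IsRankOneProj R ∧ ∃ a b : ℝ, 0 ≤ b ∧ b ≤ a ∧ a ≤ 1 ∧ A = spec R a b := by
  obtain ⟨R, hR, a, b, hab, rfl⟩ := exists_spec hA.1.isHermitian
  have := hR.spec_mem_effects_iff.1 hA
  exact ⟨R, hR, a, b, this.2.1, hab, this.1.2, rfl⟩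

theorem msqrt_mem_effects {A : M2} (hA : A ∈ effects 2) : msqrt A ∈ effects 2 := by
  obtain ⟨R, hR, a, b, hb, hab, ha, rfl⟩ := exists_spec_of_mem_effects hA
  have h : spec R a b = spec R √a √b * spec R √a √b := by
    rw [hR.spec_mul, Real.mul_self_sqrt (hb.trans hab), Real.mul_self_sqrt hb]
  rw [h, msqrt_mul_self (hR.posSemidef_spec (Real.sqrt_nonneg _) (Real.sqrt_nonneg _)),
    hR.spec_mem_effects_iff]
  exact ⟨⟨Real.sqrt_nonneg _, Real.sqrt_le_one.2 ha⟩, Real.sqrt_nonneg _,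
    Real.sqrt_le_one.2 (hab.trans ha)⟩

theorem commute_msqrt_left {A B : M2} (h : Commute A B) : Commute (msqrt A) B :=
  Commute.cfcₙ_nnreal h _

/-- Positive semidefinite matrices `a`, `b` with `a b² a = b a² b` commute: `a b` is normal and `a`
intertwines it with its adjoint, so the Fuglede–Putnam theorem gives `b a² = a² b`. -/
theorem commute_of_mul_mul_eq {a b : M2} (ha : a.PosSemidef) (hb : b.PosSemidef)
    (h : a * (b * b) * a = b * (a * a) * b) : Commute a b := by
  have hs : star (a * b) = b * a := by
    rw [star_eq_conjTranspose, conjTranspose_mul, ha.isHermitian.eq, hb.isHermitian.eq]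
  have hn : IsStarNormal (a * b) := by
    refine ⟨?_⟩
    rw [hs, Commute, SemiconjBy]
    simp only [← mul_assoc] at h ⊢
    exact h.symm
  have hn' : IsStarNormal (b * a) := hs ▸ hn.star
  have h1 : SemiconjBy a (b * a) (a * b) := (mul_assoc a b a).symm
  have h2 : Commute (a * a) b := by
    have h3 : SemiconjBy a (a * b) (b * a) := by
      have := h1.star_right hn' hn
      rwa [hs, ← hs, star_star, hs] at this
    have h4 : a * (a * b) = b * a * a := h3
    change a * a * b = b * (a * a)
    simpa only [mul_assoc] using h4
  have := commute_msqrt_left h2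
  rwa [msqrt_mul_self ha] at this

/-- Continuous sequential endomorphisms of the effect algebra of `M2`, as maps on all matrices
(with irrelevant values off the effects). -/
structure IsSeqEndoOn (Φ : M2 → M2) : Prop where
  mapsTo : ∀ A ∈ effects 2, Φ A ∈ effects 2
  continuousOn : ContinuousOn Φ (effects 2)
  map_seq : ∀ A ∈ effects 2, ∀ B ∈ effects 2,
    Φ (msqrt A * B * msqrt A) = msqrt (Φ A) * Φ B * msqrt (Φ A)

namespace IsSeqEndoOn
variable {Φ : M2 → M2}

theorem map_mul_self (h : IsSeqEndoOn Φ) {A : M2} (hA : A ∈ effects 2) :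
    Φ (A * A) = Φ A * Φ A := by
  have key : ∀ {B : M2}, B ∈ effects 2 → msqrt B * B * msqrt B = B * B := by
    intro B hB
    conv_lhs => enter [1, 2]; rw [← msqrt_mul_msqrt hB.1]
    conv_rhs => rw [← msqrt_mul_msqrt hB.1]
    simp only [mul_assoc]
  rw [← key hA, h.map_seq A hA A hA, key (h.mapsTo A hA)]

/-- A sequential endomorphism is a Jordan triple endomorphism. -/
theorem map_mul_mul (h : IsSeqEndoOn Φ) {A B : M2} (hA : A ∈ effects 2) (hB : B ∈ effects 2) :
    Φ (A * B * A) = Φ A * Φ B * Φ A := by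
  have := h.map_seq (A * A) (effects_mul_self hA) B hB
  rwa [msqrt_mul_self hA.1, h.map_mul_self hA, msqrt_mul_self (h.mapsTo A hA).1] at this

theorem map_commute (h : IsSeqEndoOn Φ) {A B : M2} (hA : A ∈ effects 2) (hB : B ∈ effects 2)
    (hAB : Commute A B) : Commute (Φ A) (Φ B) := by
  apply commute_of_mul_mul_eq (h.mapsTo A hA).1 (h.mapsTo B hB).1
  rw [← h.map_mul_self hA, ← h.map_mul_self hB, ← h.map_mul_mul hA (effects_mul_self hB),
    ← h.map_mul_mul hB (effects_mul_self hA)]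
  simp only [mul_assoc, hAB.symm.eq, hAB.symm.left_comm]

/-- A sequential endomorphism is multiplicative on commuting effects. -/
theorem map_mul (h : IsSeqEndoOn Φ) {A B : M2} (hA : A ∈ effects 2) (hB : B ∈ effects 2)
    (hAB : Commute A B) : Φ (A * B) = Φ A * Φ B := by
  have hs := msqrt_mem_effects hA
  have e := msqrt_mul_msqrt hA.1
  have c1 : Commute (msqrt A) B := commute_msqrt_left hAB
  have c2 := h.map_commute hs hB c1
  calc Φ (A * B) = Φ (msqrt A * B * msqrt A) := by rw [mul_assoc, ← c1.eq, ← mul_assoc, e]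
    _ = Φ (msqrt A) * Φ (msqrt A) * Φ B := by
        rw [h.map_mul_mul hs hB, mul_assoc, ← c2.eq, ← mul_assoc]
    _ = Φ A * Φ B := by rw [← h.map_mul_self hs, e]

end IsSeqEndoOn

/-! ### One-parameter semigroups of effects -/

/-- Continuous multiplicative maps from the half-line to `[0, 1]` are exponentials. -/
theorem exists_exp_of_mul {g : ℝ → ℝ} (hc : ContinuousOn g (Set.Ici 0))
    (hadd : ∀ x y, 0 ≤ x → 0 ≤ y → g (x + y) = g x * g y) (h0 : g 0 = 1)
    (hnn : ∀ x, 0 ≤ x → 0 ≤ g x) (hle : ∀ x, 0 ≤ x → g x ≤ 1) :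
    ∃ c : ℝ, 0 ≤ c ∧ ∀ x, 0 ≤ x → g x = Real.exp (-(c * x)) := by
  have hpow : ∀ (n : ℕ) (x : ℝ), 0 ≤ x → g (n * x) = g x ^ n := by
    intro n x hx
    induction n with
    | zero => simp [h0]
    | succ k ih =>
      rw [Nat.cast_succ, add_mul, one_mul, hadd _ _ (by positivity) hx, ih, pow_succ]
  have hpos : ∀ x, 0 ≤ x → 0 < g x := by
    intro x hx
    have ht : Tendsto (fun n : ℕ => x / ((n : ℝ) + 1)) atTop (𝓝[Set.Ici 0] 0) := by
      refine tendsto_nhdsWithin_iff.2 ⟨?_, Eventually.of_forall fun n => ?_⟩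
      · exact tendsto_const_nhds.div_atTop
          (tendsto_atTop_add_const_right _ _ tendsto_natCast_atTop_atTop)
      · exact Set.mem_Ici.2 (by positivity)
    have h1 := (hc 0 Set.self_mem_Ici).tendsto.comp ht
    rw [h0] at h1
    obtain ⟨n, hn⟩ := (h1.eventually (lt_mem_nhds one_pos)).exists
    have := hpow (n + 1) (x / ((n : ℝ) + 1)) (by positivity)
    rw [Nat.cast_succ, mul_div_cancel₀ _ (by positivity)] at this
    rw [this]
    exact pow_pos hn _
  set h : ℝ → ℝ := fun x => -Real.log (g x) with hh
  have hA : ∀ x y, 0 ≤ x → 0 ≤ y → h (x + y) = h x + h y := by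
    intro x y hx hy
    simp only [hh, hadd x y hx hy, Real.log_mul (hpos x hx).ne' (hpos y hy).ne']; ring
  -- Extend `-log g` to an additive map on the whole line.
  let f : ℝ →+ ℝ :=
    { toFun := fun x => h (max x 0) - h (max (-x) 0)
      map_zero' := by simp
      map_add' := by
        intro x y
        have e : ∀ z : ℝ, max z 0 - max (-z) 0 = z := by
          intro z; rcases le_total z 0 with hz | hz <;> simp [hz]
        have p : ∀ z : ℝ, 0 ≤ max z 0 := fun z => le_max_right _ _
        have h1 := hA _ _ (add_nonneg (p (x + y)) (p (-x))) (p (-y))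
        have h2 := hA _ _ (add_nonneg (p (-(x + y))) (p x)) (p y)
        rw [hA _ _ (p _) (p _)] at h1 h2
        have h3 : max (x + y) 0 + max (-x) 0 + max (-y) 0
            = max (-(x + y)) 0 + max x 0 + max y 0 := by
          linarith [e x, e y, e (x + y)]
        rw [h3] at h1
        linarith }
  have hhc : ContinuousOn h (Set.Ici 0) :=
    (hc.log fun x hx => (hpos x hx).ne').neg
  have hfc : Continuous f := by
    have p : ∀ u : ℝ → ℝ, Continuous u → Continuous fun x => h (max (u x) 0) := by
      intro u hu
      exact hhc.comp_continuous (hu.max continuous_const) fun x =>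
        Set.mem_Ici.2 (le_max_right _ _)
    exact (p _ continuous_id).sub (p _ continuous_neg)
  refine ⟨h 1, ?_, fun x hx => ?_⟩
  · have := Real.log_nonpos (hnn 1 zero_le_one) (hle 1 zero_le_one)
    simp only [hh]; linarith
  · have h1 := map_real_smul f hfc x 1
    have hf : ∀ z : ℝ, 0 ≤ z → f z = h z := by
      intro z hz
      have : h 0 = 0 := by simp [hh, h0]
      change h (max z 0) - h (max (-z) 0) = h z
      simp [hz, this]
    rw [smul_eq_mul, mul_one, hf x hx, hf 1 zero_le_one, smul_eq_mul] at h1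
    rw [mul_comm, ← h1]
    simp [hh, Real.exp_log (hpos x hx)]

/-- `Diag[1, 0]`, the projection onto the first basis vector. -/
def projE : M2 := !![1, 0; 0, 0]

/-- The projection onto the span of `(1, 1)`. -/
noncomputable def projX : M2 := !![1 / 2, 1 / 2; 1 / 2, 1 / 2]

/-- The projection onto the span of `(1, i)`. -/
noncomputable def projY : M2 := !![1 / 2, -Complex.I / 2; Complex.I / 2, 1 / 2]

theorem isRankOneProj_projE : IsRankOneProj projE where
  herm := by ext i j; fin_cases i <;> fin_cases j <;> simp [projE]
  idem := by ext i j; fin_cases i <;> fin_cases j <;> simp [projE, Matrix.mul_apply]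
  trace_eq := by simp [projE]

theorem isRankOneProj_projX : IsRankOneProj projX where
  herm := by ext i j; fin_cases i <;> fin_cases j <;> simp [projX]
  idem := by simp [projX]; norm_num
  trace_eq := by simp [projX, Matrix.trace_fin_two]; norm_num

theorem isRankOneProj_projY : IsRankOneProj projY where
  herm := by ext i j; fin_cases i <;> fin_cases j <;> simp [projY]
  idem := by
    ext i j; fin_cases i <;> fin_cases j <;> simp [projY, Matrix.mul_apply] <;> ring_nf <;>
      simp <;> ring
  trace_eq := by simp [projY, Matrix.trace_fin_two]; norm_num

theorem trace_projE_mul_projX : (projE * projX).trace = 1 / 2 := by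
  simp [projE, projX, Matrix.trace_fin_two]

theorem trace_projE_mul (P : M2) : (projE * P).trace.re = (P 0 0).re := by
  simp only [Matrix.trace_fin_two, Matrix.mul_apply, Fin.sum_univ_two]
  simp [projE]

theorem conjDiag_one_zero (U : M2) : conjDiag U 1 0 = U * projE * Uᴴ := by
  rw [conjDiag]; congr 2; ext i j; fin_cases i <;> fin_cases j <;> simp [projE]

theorem IsRankOneProj.conj {P U : M2} (h : IsRankOneProj P)
    (hU : U ∈ Matrix.unitaryGroup (Fin 2) ℂ) : IsRankOneProj (U * P * Uᴴ) := by
  have hu : Uᴴ * U = 1 := Matrix.mem_unitaryGroup_iff'.1 hU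
  refine ⟨?_, ?_, ?_⟩
  · rw [conjTranspose_mul, conjTranspose_mul, conjTranspose_conjTranspose, h.herm, mul_assoc]
  · calc U * P * Uᴴ * (U * P * Uᴴ) = U * P * (Uᴴ * U) * P * Uᴴ := by simp only [mul_assoc]
      _ = U * (P * P) * Uᴴ := by rw [hu, mul_one, mul_assoc U]
      _ = _ := by rw [h.idem]
  · rw [trace_mul_comm, ← mul_assoc, hu, one_mul, h.trace_eq]

theorem trace_conj_mul_conj {U : M2} (hU : U ∈ Matrix.unitaryGroup (Fin 2) ℂ) (A B : M2) :
    (U * A * Uᴴ * (U * B * Uᴴ)).trace = (A * B).trace := by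
  have hu : Uᴴ * U = 1 := Matrix.mem_unitaryGroup_iff'.1 hU
  calc (U * A * Uᴴ * (U * B * Uᴴ)).trace = (U * (A * (Uᴴ * U) * B * Uᴴ)).trace := by
        simp only [mul_assoc]
    _ = (A * B).trace := by
        rw [hu, mul_one, trace_mul_comm, mul_assoc, hu, mul_one]

/-- Commuting with a non-scalar Hermitian matrix is commuting with its spectral projections. -/
theorem mul_comm_of_spec {R X : M2} {a b : ℝ} (hab : a ≠ b)
    (h : spec R a b * X = X * spec R a b) : R * X = X * R := by
  have e : spec R a b = (a - b) • R + b • (1 : M2) := by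
    simp only [spec, smul_sub, sub_smul]; abel
  rw [e, add_mul, mul_add, smul_mul_assoc, mul_smul_comm, smul_mul_assoc, mul_smul_comm, one_mul,
    mul_one, add_left_inj] at h
  exact smul_right_injective _ (sub_ne_zero.2 hab) h

/-- A commuting family of Hermitian `2 × 2` matrices is simultaneously diagonalizable. -/
theorem exists_commuting_proj {ι : Type*} (F : ι → M2) (hF : ∀ i, (F i).IsHermitian)
    (hcomm : ∀ i j, F i * F j = F j * F i) :
    ∃ R, IsRankOneProj R ∧ ∀ i, R * F i = F i * R := by
  by_cases hs : ∃ i, ∃ R, IsRankOneProj R ∧ ∃ a b : ℝ, a ≠ b ∧ F i = spec R a b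
  · obtain ⟨i, R, hR, a, b, hab, hi⟩ := hs
    refine ⟨R, hR, fun j => mul_comm_of_spec hab ?_⟩
    rw [← hi]
    exact hcomm i j
  · refine ⟨projE, isRankOneProj_projE, fun i => ?_⟩
    obtain ⟨R, hR, a, b, -, hi⟩ := exists_spec (hF i)
    by_cases hab : a = b
    · rw [hi, hab, spec_self]; simp
    · exact absurd ⟨i, R, hR, a, b, hab, hi⟩ hs

/-- A continuous one-parameter semigroup of `2 × 2` effects is simultaneously diagonal, with
exponentials as eigenvalues. -/
theorem exists_spec_exp {G : ℝ → M2} (hc : ContinuousOn G (Set.Ici 0))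
    (hadd : ∀ x y, 0 ≤ x → 0 ≤ y → G (x + y) = G x * G y) (h0 : G 0 = 1)
    (heff : ∀ x, 0 ≤ x → G x ∈ effects 2) :
    ∃ R, IsRankOneProj R ∧ ∃ a b : ℝ, 0 ≤ a ∧ a ≤ b ∧
      ∀ x, 0 ≤ x → G x = spec R (Real.exp (-(a * x))) (Real.exp (-(b * x))) := by
  obtain ⟨R, hR, hcomm⟩ := exists_commuting_proj (fun x : Set.Ici (0 : ℝ) => G x)
    (fun x => (heff x x.2).1.isHermitian)
    (fun x y => by rw [← hadd x y x.2 y.2, ← hadd y x y.2 x.2, add_comm])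
  have key : ∀ Q, IsRankOneProj Q → (∀ x, 0 ≤ x → Q * G x = G x * Q) →
      ∃ c : ℝ, 0 ≤ c ∧ ∀ x, 0 ≤ x → (Q * G x).trace.re = Real.exp (-(c * x)) := by
    intro Q hQ hQc
    have hsp : ∀ x, 0 ≤ x → G x = spec Q (Q * G x).trace.re ((1 - Q) * G x).trace.re :=
      fun x hx => hQ.eq_spec_of_commute (heff x hx).1.isHermitian (hQc x hx)
    have hmem : ∀ x, 0 ≤ x → 0 ≤ (Q * G x).trace.re ∧ (Q * G x).trace.re ≤ 1 := by
      intro x hx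
      have := heff x hx
      rw [hsp x hx, hQ.spec_mem_effects_iff] at this
      exact this.1
    refine exists_exp_of_mul ?_ ?_ ?_ (fun x hx => (hmem x hx).1) (fun x hx => (hmem x hx).2)
    · have : Continuous fun A : M2 => (Q * A).trace.re := by fun_prop
      exact this.comp_continuousOn hc
    · intro x y hx hy
      have := hsp (x + y) (add_nonneg hx hy)
      rw [hadd x y hx hy] at this
      conv_lhs at this => rw [hsp x hx, hsp y hy, hQ.spec_mul]
      rw [hadd x y hx hy]
      exact (hQ.spec_inj this).1.symm
    · rw [h0, mul_one, hQ.trace_eq]; simp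
  obtain ⟨a, ha, hga⟩ := key R hR fun x hx => hcomm ⟨x, hx⟩
  obtain ⟨b, hb, hgb⟩ := key (1 - R) hR.compl fun x hx => by
    have := hcomm ⟨x, hx⟩
    rw [sub_mul, mul_sub, this, one_mul, mul_one]
  have hG : ∀ x, 0 ≤ x → G x = spec R (Real.exp (-(a * x))) (Real.exp (-(b * x))) := by
    intro x hx
    rw [← hga x hx, ← hgb x hx]
    exact hR.eq_spec_of_commute (heff x hx).1.isHermitian (hcomm ⟨x, hx⟩)
  rcases le_total a b with hab | hab
  · exact ⟨R, hR, a, b, ha, hab, hG⟩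
  · exact ⟨1 - R, hR.compl, b, a, hb, hab, fun x hx => by rw [hG x hx, spec_compl]⟩

/-! ### Compressions and the constancy of decay rates -/

/-- The effect with eigenvalue `1` on the range of `P` and `exp (-x)` on its complement. -/
noncomputable def damp (P : M2) (x : ℝ) : M2 := spec P 1 (Real.exp (-x))

namespace IsRankOneProj
variable {P Q R : M2}

theorem damp_mem_effects (h : IsRankOneProj P) {x : ℝ} (hx : 0 ≤ x) : damp P x ∈ effects 2 :=
  h.spec_mem_effects_iff.2
    ⟨⟨zero_le_one, le_rfl⟩, (Real.exp_pos _).le, Real.exp_le_one_iff.2 (by linarith)⟩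

theorem damp_mul (h : IsRankOneProj P) (x y : ℝ) : damp P x * damp P y = damp P (x + y) := by
  rw [damp, damp, h.spec_mul, damp, ← Real.exp_add, neg_add, one_mul]

end IsRankOneProj

theorem continuous_damp (P : M2) : Continuous (damp P) := by
  unfold damp spec; fun_prop

theorem tendsto_damp (P : M2) : Tendsto (damp P) atTop (𝓝 P) := by
  have h : Tendsto (fun x : ℝ => (1 : ℝ) • P + Real.exp (-x) • (1 - P)) atTop
      (𝓝 ((1 : ℝ) • P + (0 : ℝ) • (1 - P))) :=
    tendsto_const_nhds.add (Real.tendsto_exp_neg_atTop_nhds_zero.smul_const _)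
  have e : (1 : ℝ) • P + (0 : ℝ) • (1 - P) = P := by simp
  rw [e] at h
  exact h

theorem spec_eq_smul_damp (R : M2) {a b : ℝ} (ha : 0 < a) (hb : 0 < b) :
    spec R a b = a • damp R (Real.log a - Real.log b) := by
  rw [damp, smul_spec, neg_sub, Real.exp_sub, Real.exp_log ha, Real.exp_log hb]
  field_simp

/-- The rank one projections `P`, `Q` being at transition probability `t > 0`, the compression of
`damp Q (2 * x)` by `damp P x` has top eigenvalue tending to `t` and top eigenprojection tending
to `P` as `x → ∞`, while its determinant `exp (-4 * x)` is explicit. -/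
theorem exists_compression {P Q : M2} (hP : IsRankOneProj P) (hQ : IsRankOneProj Q)
    (ht : 0 < (P * Q).trace.re) :
    ∃ (m : ℝ → ℝ) (S : ℝ → M2), (∀ x, 0 ≤ x → IsRankOneProj (S x) ∧ 0 < m x ∧ m x ≤ 1 ∧
        0 ≤ 4 * x + 2 * Real.log (m x) ∧
        damp P x * damp Q (2 * x) * damp P x = m x • damp (S x) (4 * x + 2 * Real.log (m x))) ∧
      Tendsto m atTop (𝓝 (P * Q).trace.re) ∧ Tendsto S atTop (𝓝 P) := by
  set t := (P * Q).trace.re with htd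
  set M : ℝ → M2 := fun x => damp P x * damp Q (2 * x) * damp P x with hM
  have hdec : ∀ x : ℝ, ∃ (R : M2) (a b : ℝ), 0 ≤ x →
      IsRankOneProj R ∧ 0 ≤ b ∧ b ≤ a ∧ a ≤ 1 ∧ M x = spec R a b := by
    intro x
    by_cases hx : 0 ≤ x
    · obtain ⟨R, hR, a, b, h⟩ := exists_spec_of_mem_effects (effects_mul_mul
        (hP.damp_mem_effects hx) (hQ.damp_mem_effects (x := 2 * x) (by linarith)))
      exact ⟨R, a, b, fun _ => ⟨hR, h⟩⟩
    · exact ⟨0, 0, 0, fun h => absurd h hx⟩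
  choose S m n hS using hdec
  have hprod : ∀ x, 0 ≤ x → m x * n x = Real.exp (-(4 * x)) := by
    intro x hx
    obtain ⟨hR, -, -, -, he⟩ := hS x hx
    have h1 := hR.det_spec (m x) (n x)
    rw [← he, hM] at h1
    simp only [det_mul, damp, hP.det_spec, hQ.det_spec] at h1
    norm_cast at h1
    rw [← h1, one_mul, one_mul, ← Real.exp_add, ← Real.exp_add]
    congr 1; ring
  have hn0 : ∀ x, 0 ≤ x → 0 < n x := by
    intro x hx
    refine (hS x hx).2.1.lt_of_ne' fun h => ?_
    have := hprod x hx
    rw [h, mul_zero] at this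
    exact (Real.exp_pos _).ne this
  have hm0 : ∀ x, 0 ≤ x → 0 < m x := fun x hx => (hn0 x hx).trans_le (hS x hx).2.2.1
  have hlog : ∀ x, 0 ≤ x → 4 * x + 2 * Real.log (m x) = Real.log (m x) - Real.log (n x) := by
    intro x hx
    have := congrArg Real.log (hprod x hx)
    rw [Real.log_mul (hm0 x hx).ne' (hn0 x hx).ne', Real.log_exp] at this
    linarith
  have hMlim : Tendsto M atTop (𝓝 (t • P)) := by
    have h2 : Tendsto (fun x : ℝ => damp Q (2 * x)) atTop (𝓝 Q) :=
      (tendsto_damp Q).comp (tendsto_id.const_mul_atTop two_pos)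
    have h3 := ((tendsto_damp P).mul h2).mul (tendsto_damp P)
    have h4 : P * Q * P = t • P := by
      rw [hP.mul_mul_self]
      have : (P * Q).trace = (t : ℂ) :=
        (Complex.eq_re_of_ofReal_le (r := 0) (by simpa using hP.trace_mul_nonneg hQ.posSemidef))
      rw [this]; ext i j; simp
    rwa [h4] at h3
  have hev : ∀ᶠ x : ℝ in atTop, 0 ≤ x := eventually_ge_atTop 0
  have hnlim : Tendsto n atTop (𝓝 0) := by
    have hexp : Tendsto (fun x : ℝ => Real.exp (-(2 * x))) atTop (𝓝 0) :=
      Real.tendsto_exp_neg_atTop_nhds_zero.comp (tendsto_id.const_mul_atTop two_pos)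
    refine tendsto_of_tendsto_of_tendsto_of_le_of_le' tendsto_const_nhds hexp
      (hev.mono fun x hx => (hn0 x hx).le) (hev.mono fun x hx => ?_)
    refine (pow_le_pow_iff_left₀ (hn0 x hx).le (Real.exp_pos _).le two_ne_zero).1 ?_
    rw [← Real.exp_nat_mul]
    calc n x ^ 2 ≤ m x * n x := by
          rw [sq]; exact mul_le_mul_of_nonneg_right (hS x hx).2.2.1 (hn0 x hx).le
      _ = _ := by rw [hprod x hx]; congr 1; push_cast; ring
  have hmlim : Tendsto m atTop (𝓝 t) := by
    have hc : Continuous fun A : M2 => A.trace.re := by fun_prop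
    have h1 := (hc.tendsto _).comp hMlim
    have h2 : (t • P).trace.re = t := by rw [trace_smul, hP.trace_eq]; simp
    rw [h2] at h1
    have h3 := h1.sub hnlim
    rw [sub_zero] at h3
    refine h3.congr' (hev.mono fun x hx => ?_)
    have h4 := (hS x hx).1.trace_spec (m x) (n x)
    rw [← (hS x hx).2.2.2.2] at h4
    simp [h4]
  have hSlim : Tendsto S atTop (𝓝 P) := by
    have hd : Tendsto (fun x => m x - n x) atTop (𝓝 t) := by simpa using hmlim.sub hnlim
    have h1 : Tendsto (fun x => (m x - n x)⁻¹ • (M x - n x • (1 : M2))) atTop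
        (𝓝 (t⁻¹ • (t • P - (0 : ℝ) • (1 : M2)))) :=
      (hd.inv₀ ht.ne').smul (hMlim.sub (hnlim.smul_const _))
    rw [zero_smul, sub_zero, smul_smul, inv_mul_cancel₀ ht.ne', one_smul] at h1
    refine h1.congr' ?_
    filter_upwards [hev, hd.eventually (lt_mem_nhds ht)] with x hx hx'
    have : M x - n x • (1 : M2) = (m x - n x) • S x := by
      rw [(hS x hx).2.2.2.2, spec, smul_sub, sub_smul]; abel
    rw [this, smul_smul, inv_mul_cancel₀ hx'.ne', one_smul]
  refine ⟨m, S, fun x hx => ⟨(hS x hx).1, hm0 x hx, (hS x hx).2.2.2.1, ?_, ?_⟩, hmlim, hSlim⟩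
  · rw [hlog x hx, sub_nonneg]
    exact Real.log_le_log (hn0 x hx) (hS x hx).2.2.1
  · rw [hlog x hx, ← spec_eq_smul_damp _ (hm0 x hx) (hn0 x hx)]
    exact (hS x hx).2.2.2.2

/-- Any two rank one projections have a third one that is orthogonal to neither. -/
theorem exists_common_overlap {P Q : M2} (hP : IsRankOneProj P) (hQ : IsRankOneProj Q) :
    ∃ S, IsRankOneProj S ∧ 0 < (P * S).trace.re ∧ 0 < (Q * S).trace.re := by
  obtain ⟨U, hU, rfl⟩ := hP.exists_unitary
  have hS := isRankOneProj_projX.conj hU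
  have h1 : (conjDiag U 1 0 * (U * projX * Uᴴ)).trace = 1 / 2 := by
    rw [conjDiag_one_zero, trace_conj_mul_conj hU, trace_projE_mul_projX]
  have h2 : (conjDiag U 1 0 * (1 - U * projX * Uᴴ)).trace = 1 / 2 := by
    rw [mul_sub, mul_one, trace_sub, h1, hP.trace_eq]; norm_num
  by_cases h : 0 < (Q * (U * projX * Uᴴ)).trace.re
  · exact ⟨_, hS, by rw [h1]; norm_num, h⟩
  · refine ⟨_, hS.compl, by rw [h2]; norm_num, ?_⟩
    rw [mul_sub, mul_one, trace_sub, hQ.trace_eq, Complex.sub_re, Complex.one_re]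
    linarith

/-- If a continuous function on effects is homogeneous under scalars and submultiplicative for
the Jordan triple product, its rate of decay along `damp P` is the same for all `P`. -/
theorem decay_rate_const {N α : M2 → ℝ} {s : ℝ} (hc : ContinuousOn N (effects 2))
    (hmul : ∀ A ∈ effects 2, ∀ B ∈ effects 2, N (A * B * A) ≤ N A ^ 2 * N B)
    (hexp : ∀ P, IsRankOneProj P → ∀ x, 0 ≤ x → N (damp P x) = Real.exp (-(α P * x)))
    (hsc : ∀ A ∈ effects 2, ∀ r : ℝ, 0 < r → r ≤ 1 → N (r • A) = r ^ s * N A)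
    {P Q : M2} (hP : IsRankOneProj P) (hQ : IsRankOneProj Q) : α P = α Q := by
  have key : ∀ {P Q : M2}, IsRankOneProj P → IsRankOneProj Q → 0 < (P * Q).trace.re →
      α Q ≤ α P := by
    intro P Q hP hQ ht
    obtain ⟨m, S, hS, hm, hSlim⟩ := exists_compression hP hQ ht
    have hev : ∀ᶠ x : ℝ in atTop, 0 < x := eventually_gt_atTop 0
    have hlogm : Tendsto (fun x => Real.log (m x)) atTop (𝓝 (Real.log (P * Q).trace.re)) :=
      hm.log ht.ne'
    have hdiv : Tendsto (fun x => Real.log (m x) / x) atTop (𝓝 0) :=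
      hlogm.div_atTop tendsto_id
    -- `α` is recovered from the value of `N` at `damp _ 1`, so it is continuous along `S`.
    have hα : ∀ P, IsRankOneProj P → α P = -Real.log (N (damp P 1)) := by
      intro P hP
      rw [hexp P hP 1 zero_le_one, Real.log_exp]; ring
    have hαlim : Tendsto (fun x => α (S x)) atTop (𝓝 (α P)) := by
      have h1 : Tendsto (fun x => damp (S x) 1) atTop (𝓝 (damp P 1)) := by
        have : Continuous fun R : M2 => damp R 1 := by unfold damp spec; fun_prop
        exact (this.tendsto P).comp hSlim
      have h2 : Tendsto (fun x => N (damp (S x) 1)) atTop (𝓝 (N (damp P 1))) :=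
        (hc _ (hP.damp_mem_effects zero_le_one)).tendsto.comp
          (tendsto_nhdsWithin_iff.2 ⟨h1, hev.mono fun x hx =>
            (hS x hx.le).1.damp_mem_effects zero_le_one⟩)
      have h3 : N (damp P 1) ≠ 0 := by rw [hexp P hP 1 zero_le_one]; exact (Real.exp_pos _).ne'
      rw [hα P hP]
      exact (h2.log h3).neg.congr' (hev.mono fun x hx => (hα _ (hS x hx.le).1).symm)
    -- The logarithm of submultiplicativity on the compression, divided by `x`; in the limit the
    -- left side is `-4 * α P`.
    have hineq : ∀ᶠ x in atTop,
        s * (Real.log (m x) / x) - α (S x) * (4 + 2 * (Real.log (m x) / x))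
          ≤ -(2 * α P + 2 * α Q) := by
      filter_upwards [hev] with x hx
      obtain ⟨hR, h0, h1, hy, he⟩ := hS x hx.le
      have h2 := hmul _ (hP.damp_mem_effects hx.le) _
        (hQ.damp_mem_effects (x := 2 * x) (by linarith))
      rw [he, hsc _ (hR.damp_mem_effects hy) _ h0 h1, hexp _ hR _ hy, hexp P hP x hx.le,
        hexp Q hQ (2 * x) (by linarith), Real.rpow_def_of_pos h0, ← Real.exp_nat_mul,
        ← Real.exp_add, ← Real.exp_add, Real.exp_le_exp] at h2
      push_cast at h2
      refine le_of_mul_le_mul_right ?_ hx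
      have e1 : (s * (Real.log (m x) / x) - α (S x) * (4 + 2 * (Real.log (m x) / x))) * x
          = Real.log (m x) * s + -(α (S x) * (4 * x + 2 * Real.log (m x))) := by
        field_simp; ring
      rw [e1]; linarith
    have hlim := (hdiv.const_mul s).sub (hαlim.mul ((hdiv.const_mul 2).const_add 4))
    have := le_of_tendsto hlim hineq
    linarith
  have key2 : ∀ {P Q : M2}, IsRankOneProj P → IsRankOneProj Q → 0 < (P * Q).trace.re →
      α P = α Q := fun hP hQ ht =>
    le_antisymm (key hQ hP (by rwa [trace_mul_comm])) (key hP hQ ht)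
  obtain ⟨S, hS, h1, h2⟩ := exists_common_overlap hP hQ
  rw [key2 hP hS h1, key2 hQ hS h2]

/-! ### Sequential functionals -/

/-- Continuous functions on effects are determined by their values on invertible effects. -/
theorem eqOn_effects_of_invertible {X : Type*} [TopologicalSpace X] [T2Space X] {F H : M2 → X}
    (hF : ContinuousOn F (effects 2)) (hH : ContinuousOn H (effects 2))
    (h : ∀ R, IsRankOneProj R → ∀ a b : ℝ, 0 < b → b ≤ a → a ≤ 1 → F (spec R a b) = H (spec R a b))
    {A : M2} (hA : A ∈ effects 2) : F A = H A := by
  obtain ⟨R, hR, a, b, hb, hab, ha, rfl⟩ := exists_spec_of_mem_effects hA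
  set p : ℝ → M2 := fun t => spec R ((1 - t) * a + t) ((1 - t) * b + t) with hp
  have hpc : Continuous p := by simp only [hp, spec]; fun_prop
  have hp0 : p 0 = spec R a b := by simp [hp]
  have hev : ∀ᶠ t : ℝ in 𝓝[>] 0, 0 < t ∧ t < 1 := Ioo_mem_nhdsGT one_pos
  have hmem : ∀ t : ℝ, 0 < t ∧ t < 1 → (0 < (1 - t) * b + t ∧
      (1 - t) * b + t ≤ (1 - t) * a + t ∧ (1 - t) * a + t ≤ 1) := by
    rintro t ⟨h0, h1⟩
    have h2 : 0 ≤ 1 - t := by linarith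
    refine ⟨by positivity, ?_, ?_⟩
    · linarith [mul_le_mul_of_nonneg_left hab h2]
    · linarith [mul_le_mul_of_nonneg_left ha h2]
  have hlim : Tendsto p (𝓝[>] 0) (𝓝[effects 2] (spec R a b)) := by
    refine tendsto_nhdsWithin_iff.2 ⟨?_, hev.mono fun t ht => ?_⟩
    · rw [← hp0]; exact (hpc.tendsto 0).mono_left nhdsWithin_le_nhds
    · obtain ⟨h1, h2, h3⟩ := hmem t ht
      exact hR.spec_mem_effects_iff.2 ⟨⟨by linarith, h3⟩, h1.le, by linarith⟩
  refine tendsto_nhds_unique ((hF _ hA).tendsto.comp hlim)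
    (((hH _ hA).tendsto.comp hlim).congr' (hev.mono fun t ht => ?_))
  obtain ⟨h1, h2, h3⟩ := hmem t ht
  exact (h R hR _ _ h1 h2 h3).symm

theorem smul_one_mem_effects {r : ℝ} (h0 : 0 ≤ r) (h1 : r ≤ 1) : r • (1 : M2) ∈ effects 2 := by
  rw [← spec_self projE, isRankOneProj_projE.spec_mem_effects_iff]
  exact ⟨⟨h0, h1⟩, h0, h1⟩

theorem exp_smul_one_mem_effects {x : ℝ} (hx : 0 ≤ x) :
    Real.exp (-x) • (1 : M2) ∈ effects 2 :=
  smul_one_mem_effects (Real.exp_pos _).le (Real.exp_le_one_iff.2 (by linarith))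

theorem commute_smul_one (r : ℝ) (A : M2) : Commute (r • (1 : M2)) A := by
  simp [Commute, SemiconjBy]

theorem commute_damp {P : M2} (hP : IsRankOneProj P) (x y : ℝ) :
    Commute (damp P x) (damp P y) := by
  rw [Commute, SemiconjBy, hP.damp_mul, hP.damp_mul, add_comm]

theorem damp_compl (P : M2) (x : ℝ) : damp (1 - P) x = spec P (Real.exp (-x)) 1 := by
  rw [damp, spec_compl]

theorem IsRankOneProj.damp_mul_damp_compl {P : M2} (hP : IsRankOneProj P) (x : ℝ) :
    damp P x * damp (1 - P) x = Real.exp (-x) • (1 : M2) := by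
  rw [damp_compl, damp, hP.spec_mul, one_mul, mul_one, spec_self]

theorem IsRankOneProj.commute_damp_compl {P : M2} (hP : IsRankOneProj P) (x : ℝ) :
    Commute (damp P x) (damp (1 - P) x) := by
  rw [Commute, SemiconjBy, damp_compl, damp, hP.spec_mul, hP.spec_mul, mul_comm 1]

theorem damp_zero (P : M2) : damp P 0 = 1 := by simp [damp, spec_one_one]

/-- A function on effects that is multiplicative on commuting pairs and maps scalars to scalars by
a power is homogeneous. -/
theorem map_smul_of_exp {E : Type*} [Ring E] [Algebra ℝ E]
    {F : M2 → E} {s : ℝ}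
    (hcomm : ∀ A ∈ effects 2, ∀ B ∈ effects 2, Commute A B → F (A * B) = F A * F B)
    (hs : ∀ x : ℝ, 0 ≤ x → F (Real.exp (-x) • (1 : M2)) = Real.exp (-(s * x)) • (1 : E))
    {A : M2} (hA : A ∈ effects 2) {r : ℝ} (hr : 0 < r) (hr1 : r ≤ 1) :
    F (r • A) = r ^ s • F A := by
  have hx : 0 ≤ -Real.log r := neg_nonneg.2 (Real.log_nonpos hr.le hr1)
  have h1 := hs _ hx
  rw [neg_neg, Real.exp_log hr] at h1
  have h2 : r • A = (r • (1 : M2)) * A := by simp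
  rw [h2, hcomm _ (smul_one_mem_effects hr.le hr1) _ hA (commute_smul_one r A), h1,
    Real.rpow_def_of_pos hr, smul_mul_assoc, one_mul]
  congr 2; ring

/-- Real-valued continuous sequential functionals on effects are powers of the determinant. -/
theorem functional_eq_rpow_det {f : M2 → ℝ} (hc : ContinuousOn f (effects 2)) (hone : f 1 = 1)
    (h0 : ∀ A ∈ effects 2, 0 ≤ f A) (h1 : ∀ A ∈ effects 2, f A ≤ 1)
    (hcomm : ∀ A ∈ effects 2, ∀ B ∈ effects 2, Commute A B → f (A * B) = f A * f B)
    (htriple : ∀ A ∈ effects 2, ∀ B ∈ effects 2, f (A * B * A) = f A * f B * f A) :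
    ∃ c : ℝ, 0 ≤ c ∧ ∀ A ∈ effects 2, f A = A.det.re ^ c := by
  have hexp : ∀ P, IsRankOneProj P → ∃ c : ℝ, 0 ≤ c ∧
      ∀ x, 0 ≤ x → f (damp P x) = Real.exp (-(c * x)) := by
    intro P hP
    refine exists_exp_of_mul (hc.comp (continuous_damp P).continuousOn fun x hx =>
      hP.damp_mem_effects hx) (fun x y hx hy => ?_) ?_
      (fun x hx => h0 _ (hP.damp_mem_effects hx)) (fun x hx => h1 _ (hP.damp_mem_effects hx))
    · rw [← hP.damp_mul, hcomm _ (hP.damp_mem_effects hx) _ (hP.damp_mem_effects hy)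
        (commute_damp hP x y)]
    · rw [damp_zero, hone]
  choose! α hα using hexp
  obtain ⟨s, -, hs⟩ := exists_exp_of_mul (g := fun x => f (Real.exp (-x) • (1 : M2)))
    (hc.comp (by fun_prop) fun x hx => exp_smul_one_mem_effects hx)
    (fun x y hx hy => by
      rw [← hcomm _ (exp_smul_one_mem_effects hx) _ (exp_smul_one_mem_effects hy)
        (commute_smul_one _ _), neg_add, Real.exp_add, smul_mul_smul_comm, mul_one])
    (by simp [hone]) (fun x hx => h0 _ (exp_smul_one_mem_effects hx))
    (fun x hx => h1 _ (exp_smul_one_mem_effects hx))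
  have hsc : ∀ A ∈ effects 2, ∀ r : ℝ, 0 < r → r ≤ 1 → f (r • A) = r ^ s * f A := by
    intro A hA r hr hr1
    exact map_smul_of_exp hcomm (fun x hx => by rw [hs x hx, smul_eq_mul, mul_one]) hA hr hr1
  have hconst : ∀ P, IsRankOneProj P → α P = α projE := fun P hP =>
    decay_rate_const hc (fun A hA B hB => by rw [htriple A hA B hB]; apply le_of_eq; ring)
      (fun P hP => (hα P hP).2) hsc hP isRankOneProj_projE
  have hsα : s = 2 * α projE := by
    have hE := isRankOneProj_projE
    have h2 := hcomm _ (hE.damp_mem_effects zero_le_one) _ (hE.compl.damp_mem_effects zero_le_one)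
      (hE.commute_damp_compl 1)
    rw [hE.damp_mul_damp_compl, hs 1 zero_le_one, (hα _ hE).2 1 zero_le_one,
      (hα _ hE.compl).2 1 zero_le_one, hconst _ hE.compl, ← Real.exp_add,
      Real.exp_eq_exp] at h2
    linarith
  have hc0 : 0 ≤ α projE := (hα _ isRankOneProj_projE).1
  refine ⟨α projE, hc0, fun A hA => ?_⟩
  refine eqOn_effects_of_invertible (H := fun A => A.det.re ^ α projE) hc ?_ ?_ hA
  · have : Continuous fun A : M2 => A.det.re := by fun_prop
    exact (this.rpow_const fun _ => Or.inr hc0).continuousOn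
  · intro R hR a b hb hab ha
    have ha0 : 0 < a := hb.trans_le hab
    have hy : 0 ≤ Real.log a - Real.log b := sub_nonneg.2 (Real.log_le_log hb hab)
    have hdet : (spec R a b).det.re = a * b := by
      rw [hR.det_spec]; norm_cast
    rw [hdet, spec_eq_smul_damp R ha0 hb, hsc _ (hR.damp_mem_effects hy) a ha0 ha,
      (hα R hR).2 _ hy, hconst R hR, hsα, Real.rpow_def_of_pos ha0,
      Real.rpow_def_of_pos (mul_pos ha0 hb), Real.log_mul ha0.ne' hb.ne', ← Real.exp_add]
    congr 1; ring

/-! ### Diagonal endomorphisms and transition probabilities -/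

namespace IsSeqEndoOn
variable {Φ : M2 → M2}

/-- If `Q` commutes with the range of a sequential endomorphism and is fixed by the image of the
identity, the corresponding diagonal entry is a power of the determinant. -/
theorem trace_mul_eq_rpow_det (h : IsSeqEndoOn Φ) {Q : M2} (hQ : IsRankOneProj Q)
    (hcomm : ∀ A ∈ effects 2, Q * Φ A = Φ A * Q) (hone : (Q * Φ 1).trace.re = 1) :
    ∃ c : ℝ, 0 ≤ c ∧ ∀ A ∈ effects 2, (Q * Φ A).trace.re = A.det.re ^ c := by
  have hsp : ∀ A ∈ effects 2, Φ A = spec Q (Q * Φ A).trace.re ((1 - Q) * Φ A).trace.re :=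
    fun A hA => hQ.eq_spec_of_commute (h.mapsTo A hA).1.isHermitian (hcomm A hA)
  have hmem : ∀ A ∈ effects 2, 0 ≤ (Q * Φ A).trace.re ∧ (Q * Φ A).trace.re ≤ 1 := by
    intro A hA
    have := h.mapsTo A hA
    rw [hsp A hA, hQ.spec_mem_effects_iff] at this
    exact this.1
  have hcont : Continuous fun X : M2 => (Q * X).trace.re := by fun_prop
  refine functional_eq_rpow_det (f := fun A => (Q * Φ A).trace.re)
    (hcont.comp_continuousOn h.continuousOn) hone (fun A hA => (hmem A hA).1)
    (fun A hA => (hmem A hA).2) (fun A hA B hB hAB => ?_) (fun A hA B hB => ?_)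
  · have e := congrArg (fun X => (Q * X).trace.re) (h.map_mul hA hB hAB)
    rw [e]
    conv_lhs => rw [hsp A hA, hsp B hB, hQ.spec_mul, hQ.trace_mul_spec, Complex.ofReal_re]
  · have e := congrArg (fun X => (Q * X).trace.re) (h.map_mul_mul hA hB)
    rw [e]
    conv_lhs => rw [hsp A hA, hsp B hB, hQ.spec_mul, hQ.spec_mul, hQ.trace_mul_spec,
      Complex.ofReal_re]

/-- A unital sequential endomorphism with range commuting with a rank one projection is diagonal,
with powers of the determinant as entries. -/
theorem eq_spec_rpow_det (h : IsSeqEndoOn Φ) (hone : Φ 1 = 1) {R : M2} (hR : IsRankOneProj R)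
    (hcomm : ∀ A ∈ effects 2, R * Φ A = Φ A * R) :
    ∃ c₁ c₂ : ℝ, 0 ≤ c₁ ∧ 0 ≤ c₂ ∧
      ∀ A ∈ effects 2, Φ A = spec R (A.det.re ^ c₁) (A.det.re ^ c₂) := by
  obtain ⟨c₁, h1, hc1⟩ := h.trace_mul_eq_rpow_det hR hcomm (by
    rw [hone, mul_one, hR.trace_eq, Complex.one_re])
  obtain ⟨c₂, h2, hc2⟩ := h.trace_mul_eq_rpow_det hR.compl
    (fun A hA => by rw [sub_mul, mul_sub, hcomm A hA, one_mul, mul_one]) (by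
    rw [hone, mul_one, hR.compl.trace_eq, Complex.one_re])
  refine ⟨c₁, c₂, h1, h2, fun A hA => ?_⟩
  rw [← hc1 A hA, ← hc2 A hA]
  exact hR.eq_spec_of_commute (h.mapsTo A hA).1.isHermitian (hcomm A hA)

/-- The image of the identity is a projection. -/
theorem map_one_cases (h : IsSeqEndoOn Φ) :
    Φ 1 = 0 ∨ IsRankOneProj (Φ 1) ∨ Φ 1 = 1 := by
  have h1 := h.map_mul_self one_mem_effects
  rw [mul_one] at h1
  obtain ⟨R, hR, a, b, hb, hab, ha, he⟩ := exists_spec_of_mem_effects (h.mapsTo 1 one_mem_effects)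
  rw [he, hR.spec_mul] at h1
  obtain ⟨h2, h3⟩ := hR.spec_inj h1
  have h2' : a = 0 ∨ a = 1 := by
    by_cases h0 : a = 0
    · exact Or.inl h0
    · exact Or.inr (mul_left_cancel₀ h0 (by linarith))
  have h3' : b = 0 ∨ b = 1 := by
    by_cases h0 : b = 0
    · exact Or.inl h0
    · exact Or.inr (mul_left_cancel₀ h0 (by linarith))
  rcases h2' with rfl | rfl <;> rcases h3' with rfl | rfl
  · left; rw [he, spec_self, zero_smul]
  · linarith
  · right; left; rw [he, spec_one_zero]; exact hR
  · right; right; rw [he, spec_one_one]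

theorem map_mul_map_one (h : IsSeqEndoOn Φ) {A : M2} (hA : A ∈ effects 2) :
    Φ A * Φ 1 = Φ A ∧ Φ 1 * Φ A = Φ A := by
  rw [← h.map_mul hA one_mem_effects (Commute.one_right A),
    ← h.map_mul one_mem_effects hA (Commute.one_left A), mul_one, one_mul]
  exact ⟨rfl, rfl⟩

/-- A sequential endomorphism of rank one is a power of the determinant times a projection. -/
theorem eq_rpow_det_smul_of_rankOne (h : IsSeqEndoOn Φ) (hp : IsRankOneProj (Φ 1)) :
    ∃ c : ℝ, 0 ≤ c ∧ ∀ A ∈ effects 2, Φ A = (A.det.re ^ c) • Φ 1 := by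
  obtain ⟨c, hc, hf⟩ := h.trace_mul_eq_rpow_det hp (fun A hA => by
    rw [(h.map_mul_map_one hA).1, (h.map_mul_map_one hA).2]) (by
    rw [hp.idem, hp.trace_eq, Complex.one_re])
  refine ⟨c, hc, fun A hA => ?_⟩
  have h1 := hp.eq_spec_of_commute (h.mapsTo A hA).1.isHermitian (by
    rw [(h.map_mul_map_one hA).1, (h.map_mul_map_one hA).2])
  have h2 := congrArg (Φ 1 * ·) h1
  simp only [(h.map_mul_map_one hA).2, hp.mul_spec] at h2
  rw [h2, ← hf A hA, (h.map_mul_map_one hA).2]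

end IsSeqEndoOn

theorem det_eq_ofReal_re {A : M2} (hA : A ∈ effects 2) : A.det = (A.det.re : ℂ) := by
  obtain ⟨R, hR, a, b, -, -, -, rfl⟩ := exists_spec_of_mem_effects hA
  rw [hR.det_spec]; norm_cast

theorem spec_exp_exp (R : M2) (a b x : ℝ) :
    spec R (Real.exp (-(a * x))) (Real.exp (-(b * x)))
      = Real.exp (-(a * x)) • damp R ((b - a) * x) := by
  rw [damp, smul_spec, mul_one, ← Real.exp_add]
  congr 2; ring

/-- The map `P ↦ R P` on rank one projections induced by a homogeneous sequential endomorphism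
preserves transition probabilities up to a power: compare traces of the images of the compressions
of `exists_compression`, after factoring out the leading exponentials. -/
theorem IsSeqEndoOn.trace_mul_eq_rpow {Φ : M2 → M2} (h : IsSeqEndoOn Φ) {R : M2 → M2} {a b : ℝ}
    (hab : a < b)
    (hR : ∀ P, IsRankOneProj P → IsRankOneProj (R P) ∧ ∀ x, 0 ≤ x →
      Φ (damp P x) = spec (R P) (Real.exp (-(a * x))) (Real.exp (-(b * x))))
    (hsc : ∀ A ∈ effects 2, ∀ r : ℝ, 0 < r → r ≤ 1 → Φ (r • A) = r ^ (a + b) • Φ A)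
    {P Q : M2} (hP : IsRankOneProj P) (hQ : IsRankOneProj Q) (ht : 0 < (P * Q).trace.re) :
    (R P * R Q).trace.re = (P * Q).trace.re ^ (b - a) := by
  obtain ⟨m, S, hS, hm, -⟩ := exists_compression hP hQ ht
  have hγ : 0 < b - a := sub_pos.2 hab
  have hid : ∀ x, 0 ≤ x → (damp (R P) ((b - a) * x) * damp (R Q) ((b - a) * (2 * x)) *
      damp (R P) ((b - a) * x)).trace.re
      = m x ^ (b - a) * (1 + Real.exp (-((b - a) * (4 * x + 2 * Real.log (m x))))) := by
    intro x hx
    obtain ⟨hSx, h0, h1, hy, he⟩ := hS x hx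
    set y := 4 * x + 2 * Real.log (m x) with hyd
    have h2 := h.map_mul_mul (hP.damp_mem_effects hx)
      (hQ.damp_mem_effects (x := 2 * x) (by linarith))
    rw [he, hsc _ (hSx.damp_mem_effects hy) _ h0 h1, (hR _ hSx).2 _ hy, (hR _ hP).2 _ hx,
      (hR _ hQ).2 (2 * x) (by linarith), spec_exp_exp, spec_exp_exp, spec_exp_exp,
      smul_mul_smul_comm, smul_mul_smul_comm, smul_smul] at h2
    have e1 : Real.exp (-(a * x)) * Real.exp (-(a * (2 * x))) * Real.exp (-(a * x))
        = Real.exp (-(4 * a * x)) := by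
      rw [← Real.exp_add, ← Real.exp_add]; congr 1; ring
    have e2 : m x ^ (a + b) * Real.exp (-(a * y))
        = Real.exp (-(4 * a * x)) * m x ^ (b - a) := by
      rw [Real.rpow_def_of_pos h0, Real.rpow_def_of_pos h0, ← Real.exp_add, ← Real.exp_add, hyd]
      congr 1; ring
    rw [e1, e2, mul_smul] at h2
    have h3 := smul_right_injective M2 (Real.exp_pos (-(4 * a * x))).ne' h2
    rw [← h3, trace_smul, damp, (hR _ hSx).1.trace_spec]
    rw [Complex.smul_re, ← Complex.ofReal_add, Complex.ofReal_re, smul_eq_mul]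
  have hev : ∀ᶠ x : ℝ in atTop, 0 ≤ x := eventually_ge_atTop 0
  have hγt : Tendsto (fun x : ℝ => (b - a) * x) atTop atTop := tendsto_id.const_mul_atTop hγ
  have h2t : Tendsto (fun x : ℝ => 2 * x) atTop atTop := tendsto_id.const_mul_atTop two_pos
  have hL : Tendsto (fun x : ℝ => (damp (R P) ((b - a) * x) * damp (R Q) ((b - a) * (2 * x)) *
      damp (R P) ((b - a) * x)).trace.re) atTop (𝓝 (R P * R Q).trace.re) := by
    have hc : Continuous fun A : M2 => A.trace.re := by fun_prop
    have h1 := (hc.tendsto _).comp ((((tendsto_damp (R P)).comp hγt).mul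
      ((tendsto_damp (R Q)).comp (hγt.comp h2t))).mul ((tendsto_damp (R P)).comp hγt))
    have h2 : (R P * R Q * R P).trace = (R P * R Q).trace := by
      rw [trace_mul_comm, ← mul_assoc, (hR P hP).1.idem]
    rw [h2] at h1
    exact h1
  have hyt : Tendsto (fun x : ℝ => (b - a) * (4 * x + 2 * Real.log (m x))) atTop atTop :=
    ((tendsto_id.const_mul_atTop (by norm_num : (0 : ℝ) < 4)).atTop_add
      ((hm.log ht.ne').const_mul 2)).const_mul_atTop hγ
  have hRt := (hm.rpow_const (p := b - a) (Or.inl ht.ne')).mul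
    ((Real.tendsto_exp_neg_atTop_nhds_zero.comp hyt).const_add 1)
  rw [add_zero, mul_one] at hRt
  exact tendsto_nhds_unique hL (hRt.congr' (hev.mono fun x hx => (hid x hx).symm))

/-! ### Endomorphisms mapping scalars to scalars -/

/-- A sequential endomorphism whose values at scalars are scalars is either a power of the
determinant, or such a power times a map acting on spectral projections only, by a symmetry of
transition probabilities. -/
theorem IsSeqEndoOn.scalar_cases {Φ : M2 → M2} (h : IsSeqEndoOn Φ) {s : ℝ}
    (hs : ∀ x : ℝ, 0 ≤ x → Φ (Real.exp (-x) • (1 : M2)) = Real.exp (-(s * x)) • (1 : M2)) :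
    ∃ a : ℝ, 0 ≤ a ∧ ((∀ A ∈ effects 2, Φ A = (A.det.re ^ a) • (1 : M2)) ∨
      ∃ R : M2 → M2, (∀ P, IsRankOneProj P → IsRankOneProj (R P)) ∧
        (∀ P Q, IsRankOneProj P → IsRankOneProj Q →
          (R P * R Q).trace.re = (P * Q).trace.re) ∧
        ∀ P, IsRankOneProj P → ∀ x y : ℝ, 0 < y → y ≤ x → x ≤ 1 →
          Φ (spec P x y) = ((x * y) ^ a) • spec (R P) x y) := by
  have hone : Φ 1 = 1 := by simpa using hs 0 le_rfl
  have hexp : ∀ P, IsRankOneProj P → ∃ R, IsRankOneProj R ∧ ∃ a b : ℝ, 0 ≤ a ∧ a ≤ b ∧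
      ∀ x, 0 ≤ x → Φ (damp P x) = spec R (Real.exp (-(a * x))) (Real.exp (-(b * x))) := by
    intro P hP
    refine exists_spec_exp (h.continuousOn.comp (continuous_damp P).continuousOn fun x hx =>
      hP.damp_mem_effects hx) (fun x y hx hy => ?_) (by rw [damp_zero, hone])
      (fun x hx => h.mapsTo _ (hP.damp_mem_effects hx))
    rw [← hP.damp_mul, h.map_mul (hP.damp_mem_effects hx) (hP.damp_mem_effects hy)
      (commute_damp hP x y)]
  choose! R hRp α β hα0 hαβ hR using hexp
  have hsc : ∀ A ∈ effects 2, ∀ r : ℝ, 0 < r → r ≤ 1 → Φ (r • A) = r ^ s • Φ A :=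
    fun A hA r hr hr1 =>
      map_smul_of_exp (fun A hA B hB hAB => h.map_mul hA hB hAB) hs hA hr hr1
  have hE := isRankOneProj_projE
  have hα : ∀ P, IsRankOneProj P → α P = α projE := fun P hP =>
    decay_rate_const (N := fun A => ‖Φ A‖) (s := s) h.continuousOn.norm
      (fun A hA B hB => by
        rw [h.map_mul_mul hA hB, sq, mul_right_comm]
        exact (norm_mul_le _ _).trans (mul_le_mul_of_nonneg_right (norm_mul_le _ _)
          (norm_nonneg _)))
      (fun P hP x hx => by
        rw [hR P hP x hx, (hRp P hP).norm_spec (Real.exp_pos _).le]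
        exact Real.exp_le_exp.2 (neg_le_neg (mul_le_mul_of_nonneg_right (hαβ P hP) hx)))
      (fun A hA r hr hr1 => by
        rw [hsc A hA r hr hr1, norm_smul, Real.norm_of_nonneg (Real.rpow_nonneg hr.le s)]) hP hE
  have hdetc : Continuous fun A : M2 => A.det.re := by fun_prop
  have hdet : ∀ P, IsRankOneProj P → α P + β P = α projE + β projE := fun P hP =>
    decay_rate_const (N := fun A => (Φ A).det.re) (α := fun P => α P + β P) (s := s * 2)
      (hdetc.comp_continuousOn h.continuousOn)
      (fun A hA B hB => by
        rw [h.map_mul_mul hA hB, det_mul, det_mul, det_eq_ofReal_re (h.mapsTo A hA),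
          det_eq_ofReal_re (h.mapsTo B hB)]
        norm_cast
        apply le_of_eq; ring)
      (fun P hP x hx => by
        rw [hR P hP x hx, (hRp P hP).det_spec]
        norm_cast
        rw [← Real.exp_add]; congr 1; ring)
      (fun A hA r hr hr1 => by
        rw [hsc A hA r hr hr1, ← algebraMap_smul ℂ (r ^ s), det_smul, Real.rpow_mul hr.le]
        simp only [Fintype.card_fin, Complex.coe_algebraMap, Real.rpow_ofNat]
        norm_cast
        rw [Complex.re_ofReal_mul]) hP hE
  have hβ : ∀ P, IsRankOneProj P → β P = β projE := fun P hP => by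
    linarith [hdet P hP, hα P hP]
  set a := α projE with ha
  set b := β projE with hb
  have ha0 : 0 ≤ a := hα0 _ hE
  have hprod : ∀ P, IsRankOneProj P → Φ (damp P 1) * Φ (damp (1 - P) 1)
      = Real.exp (-s) • (1 : M2) := by
    intro P hP
    rw [← h.map_mul (hP.damp_mem_effects zero_le_one) (hP.compl.damp_mem_effects zero_le_one)
      (hP.commute_damp_compl 1), hP.damp_mul_damp_compl, hs 1 zero_le_one, mul_one]
  have hR' : ∀ P, IsRankOneProj P → IsRankOneProj (R P) ∧ ∀ x, 0 ≤ x →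
      Φ (damp P x) = spec (R P) (Real.exp (-(a * x))) (Real.exp (-(b * x))) := by
    intro P hP
    refine ⟨hRp P hP, fun x hx => ?_⟩
    rw [hR P hP x hx, hα P hP, hβ P hP]
  have hsab : s = a + b := by
    have h1 := congrArg Matrix.det (hprod projE hE)
    rw [(hR' _ hE).2 1 zero_le_one, (hR' _ hE.compl).2 1 zero_le_one, det_mul,
      (hRp _ hE).det_spec, (hRp _ hE.compl).det_spec, ← spec_self projE, hE.det_spec] at h1
    norm_cast at h1
    simp only [← Real.exp_add, Real.exp_eq_exp] at h1
    linarith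
  have hform : ∀ P, IsRankOneProj P → ∀ x y : ℝ, 0 < y → y ≤ x → x ≤ 1 →
      Φ (spec P x y) = (x * y) ^ a • (x ^ (b - a) •
        damp (R P) ((b - a) * (Real.log x - Real.log y))) := by
    intro P hP x y hy hyx hx
    have hx0 : 0 < x := hy.trans_le hyx
    have hl : 0 ≤ Real.log x - Real.log y := sub_nonneg.2 (Real.log_le_log hy hyx)
    rw [spec_eq_smul_damp P hx0 hy, hsc _ (hP.damp_mem_effects hl) x hx0 hx, (hR' P hP).2 _ hl,
      spec_exp_exp, smul_smul, smul_smul]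
    congr 1
    rw [Real.rpow_def_of_pos hx0, Real.rpow_def_of_pos hx0, Real.rpow_def_of_pos (mul_pos hx0 hy),
      Real.log_mul hx0.ne' hy.ne', ← Real.exp_add, ← Real.exp_add, hsab]
    congr 1; ring
  refine ⟨a, ha0, ?_⟩
  rcases (hαβ _ hE).eq_or_lt with hab | hab
  · left
    intro A hA
    refine eqOn_effects_of_invertible (H := fun A : M2 => (A.det.re ^ a) • (1 : M2))
      h.continuousOn ?_ ?_ hA
    · exact ((hdetc.rpow_const fun _ => Or.inr ha0).smul continuous_const).continuousOn
    · intro P hP x y hy hyx hx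
      have hd : (spec P x y).det.re = x * y := by rw [hP.det_spec]; norm_cast
      have hab' : b - a = 0 := by rw [sub_eq_zero, ha, hb, hab]
      rw [hform P hP x y hy hyx hx, hd, hab', zero_mul, damp_zero, Real.rpow_zero,
        one_smul]
  · right
    have hRc : ∀ P, IsRankOneProj P → R (1 - P) = 1 - R P := by
      intro P hP
      have h1 := hprod P hP
      have hp := hRp P hP
      rw [(hR' _ hP).2 1 zero_le_one, (hR' _ hP.compl).2 1 zero_le_one, mul_one, mul_one] at h1
      have h2 := congrArg (spec (R P) (Real.exp a) (Real.exp b) * ·) h1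
      simp only [← mul_assoc, hp.spec_mul, ← Real.exp_add, add_neg_cancel, Real.exp_zero,
        spec_one_one, one_mul, mul_smul_comm, mul_one, smul_spec] at h2
      rw [hsab, show -(a + b) + a = -b by ring, show -(a + b) + b = -a by ring,
        ← spec_compl (R P)] at h2
      have h3 : ∀ T : M2, spec T (Real.exp (-a)) (Real.exp (-b))
          = (Real.exp (-a) - Real.exp (-b)) • T + Real.exp (-b) • (1 : M2) := by
        intro T; simp only [spec, smul_sub, sub_smul]; abel
      rw [h3, h3, add_left_inj] at h2
      exact smul_right_injective M2
        (sub_ne_zero.2 fun he => hab.ne (neg_injective (Real.exp_injective he))) h2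
    have htr : ∀ P Q, IsRankOneProj P → IsRankOneProj Q → 0 < (P * Q).trace.re →
        (R P * R Q).trace.re = (P * Q).trace.re ^ (b - a) := fun P Q hP hQ ht =>
      h.trace_mul_eq_rpow hab hR' (fun A hA r hr hr1 => by rw [← hsab]; exact hsc A hA r hr hr1)
        hP hQ ht
    have hsum : ∀ P Q : M2, IsRankOneProj P →
        (P * (1 - Q)).trace.re = 1 - (P * Q).trace.re := by
      intro P Q hP
      rw [mul_sub, mul_one, trace_sub, hP.trace_eq, Complex.sub_re, Complex.one_re]
    -- Transition probabilities to `Q` and `1 - Q` add up to one, before and after applying `R`.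
    have hγ : b - a = 1 := by
      have hX := isRankOneProj_projX
      have e1 : (projE * projX).trace.re = 1 / 2 := by rw [trace_projE_mul_projX]; norm_num
      have e2 : (projE * (1 - projX)).trace.re = 1 / 2 := by
        rw [hsum _ _ hE, e1]; norm_num
      have h1 := htr projE projX hE hX (by rw [e1]; norm_num)
      have h2 := htr projE (1 - projX) hE hX.compl (by rw [e2]; norm_num)
      rw [hRc _ hX, hsum _ _ (hRp _ hE), h1, e1, e2] at h2
      have h3 : ((1 : ℝ) / 2) ^ (b - a) = (1 / 2) ^ (1 : ℝ) := by rw [Real.rpow_one]; linarith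
      exact (Real.rpow_right_inj (by norm_num) (by norm_num)).1 h3
    refine ⟨R, hRp, fun P Q hP hQ => ?_, fun P hP x y hy hyx hx => ?_⟩
    · by_cases ht : 0 < (P * Q).trace.re
      · rw [htr P Q hP hQ ht, hγ, Real.rpow_one]
      · have h0 : (P * Q).trace.re = 0 := le_antisymm (not_lt.1 ht)
          (Complex.le_def.1 (hP.trace_mul_nonneg hQ.posSemidef)).1
        have h1 := htr P (1 - Q) hP hQ.compl (by rw [hsum P Q hP, h0]; norm_num)
        rw [hRc Q hQ, hsum _ _ (hRp P hP), hsum P Q hP, h0, sub_zero, Real.one_rpow] at h1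
        rw [h0]; linarith
    · have hx0 : 0 < x := hy.trans_le hyx
      rw [hform P hP x y hy hyx hx, hγ, one_mul, Real.rpow_one, ← spec_eq_smul_damp _ hx0 hy]

/-! ### Symmetries of transition probabilities -/

namespace IsRankOneProj
variable {P Q : M2}

theorem apply_one_zero (h : IsRankOneProj P) : P 1 0 = (starRingEnd ℂ) (P 0 1) := by
  conv_lhs => rw [← h.herm]
  simp

theorem apply_one_one (h : IsRankOneProj P) : P 1 1 = 1 - P 0 0 := by
  have := h.trace_eq
  rw [Matrix.trace_fin_two] at this
  linear_combination this

theorem im_apply_zero_zero (h : IsRankOneProj P) : (P 0 0).im = 0 := by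
  have : P 0 0 = (starRingEnd ℂ) (P 0 0) := by conv_lhs => rw [← h.herm]; simp
  exact Complex.conj_eq_iff_im.1 this.symm

theorem normSq_apply_zero_one (h : IsRankOneProj P) :
    P 0 1 * (starRingEnd ℂ) (P 0 1) = P 0 0 * (1 - P 0 0) := by
  have := h.det_eq_zero
  rw [det_fin_two, h.apply_one_zero, h.apply_one_one] at this
  linear_combination -this

theorem eq_of_apply (hP : IsRankOneProj P) (hQ : IsRankOneProj Q) (h0 : (P 0 0).re = (Q 0 0).re)
    (h1 : P 0 1 = Q 0 1) : P = Q := by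
  have h00 : P 0 0 = Q 0 0 :=
    Complex.ext h0 (by rw [hP.im_apply_zero_zero, hQ.im_apply_zero_zero])
  ext i j; fin_cases i <;> fin_cases j
  · exact h00
  · exact h1
  · change P 1 0 = Q 1 0
    rw [hP.apply_one_zero, hQ.apply_one_zero, h1]
  · change P 1 1 = Q 1 1
    rw [hP.apply_one_one, hQ.apply_one_one, h00]

theorem trace_projX_mul (h : IsRankOneProj P) :
    (projX * P).trace.re = 1 / 2 + (P 0 1).re := by
  simp only [Matrix.trace_fin_two, Matrix.mul_apply, Fin.sum_univ_two, h.apply_one_zero,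
    h.apply_one_one]
  simp [projX]
  ring

theorem trace_projY_mul (h : IsRankOneProj P) :
    (projY * P).trace.re = 1 / 2 - (P 0 1).im := by
  simp only [Matrix.trace_fin_two, Matrix.mul_apply, Fin.sum_univ_two, h.apply_one_zero,
    h.apply_one_one]
  simp [projY]
  ring

theorem transpose (h : IsRankOneProj P) : IsRankOneProj Pᵀ where
  herm := by
    have : Pᵀᴴ = Pᴴᵀ := by ext i j; simp
    rw [this, h.herm]
  idem := by rw [← transpose_mul, h.idem]
  trace_eq := by rw [trace_transpose, h.trace_eq]

end IsRankOneProj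

/-- Two rank one projections at transition probability `1 / 2` are simultaneously unitarily
equivalent to `projE` and `projX`. -/
theorem exists_unitary_pair {A B : M2} (hA : IsRankOneProj A) (hB : IsRankOneProj B)
    (hAB : (A * B).trace.re = 1 / 2) : ∃ V ∈ Matrix.unitaryGroup (Fin 2) ℂ,
      A = V * projE * Vᴴ ∧ B = V * projX * Vᴴ := by
  obtain ⟨U, hU, rfl⟩ := hA.exists_unitary
  rw [conjDiag_one_zero] at hAB ⊢
  have hu : U * Uᴴ = 1 := Matrix.mem_unitaryGroup_iff.1 hU
  have hB' : IsRankOneProj (Uᴴ * B * Uᴴᴴ) := hB.conj (Unitary.star_mem hU)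
  set C := Uᴴ * B * Uᴴᴴ with hC
  have hBC : B = U * C * Uᴴ := by
    rw [hC, conjTranspose_conjTranspose]
    calc B = (U * Uᴴ) * B * (U * Uᴴ) := by rw [hu]; simp
      _ = _ := by simp only [mul_assoc]
  have h0 : C 0 0 = 1 / 2 := by
    rw [hBC, trace_conj_mul_conj hU, trace_projE_mul] at hAB
    exact Complex.ext (by rw [hAB]; norm_num) (by rw [hB'.im_apply_zero_zero]; norm_num)
  have hz : C 0 1 * (starRingEnd ℂ) (C 0 1) = 1 / 4 := by
    rw [hB'.normSq_apply_zero_one, h0]; norm_num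
  -- A diagonal unitary rotates the off-diagonal entry to `1 / 2` and fixes `projE`.
  set D : M2 := !![1, 0; 0, 2 * (starRingEnd ℂ) (C 0 1)] with hD
  have hDu : D ∈ Matrix.unitaryGroup (Fin 2) ℂ := by
    rw [Matrix.mem_unitaryGroup_iff]
    ext i j; fin_cases i <;> fin_cases j <;>
      simp [hD, Matrix.mul_apply, star_eq_conjTranspose]
    rw [map_ofNat]
    linear_combination 4 * hz
  have hDE : D * projE * Dᴴ = projE := by
    ext i j; fin_cases i <;> fin_cases j <;> simp [hD, projE, Matrix.mul_apply]
  have hDX : D * projX * Dᴴ = C := by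
    refine (isRankOneProj_projX.conj hDu).eq_of_apply hB' ?_ ?_
    · rw [h0]; simp [hD, projX, Matrix.mul_apply]
    · simp [hD, projX, Matrix.mul_apply]
      rw [map_ofNat]; ring
  refine ⟨U * D, mul_mem hU hDu, ?_, ?_⟩
  · rw [conjTranspose_mul]
    calc U * projE * Uᴴ = U * (D * projE * Dᴴ) * Uᴴ := by rw [hDE]
      _ = _ := by simp only [mul_assoc]
  · rw [conjTranspose_mul, hBC]
    calc U * C * Uᴴ = U * (D * projX * Dᴴ) * Uᴴ := by rw [hDX]
      _ = _ := by simp only [mul_assoc]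

/-- A symmetry of transition probabilities fixing `projE` and `projX` is the identity or the
transposition. -/
theorem eq_self_or_transpose {R : M2 → M2} (hR : ∀ P, IsRankOneProj P → IsRankOneProj (R P))
    (htr : ∀ P Q, IsRankOneProj P → IsRankOneProj Q → (R P * R Q).trace.re = (P * Q).trace.re)
    (hE : R projE = projE) (hX : R projX = projX) :
    (∀ P, IsRankOneProj P → R P = P) ∨ ∀ P, IsRankOneProj P → R P = Pᵀ := by
  have h00 : ∀ P, IsRankOneProj P → (R P 0 0).re = (P 0 0).re := by
    intro P hP
    have := htr _ P isRankOneProj_projE hP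
    rwa [hE, trace_projE_mul, trace_projE_mul] at this
  have h01 : ∀ P, IsRankOneProj P → (R P 0 1).re = (P 0 1).re := by
    intro P hP
    have := htr _ P isRankOneProj_projX hP
    rwa [hX, (hR P hP).trace_projX_mul, hP.trace_projX_mul, add_right_inj] at this
  have hY := isRankOneProj_projY
  have hRY := hR _ hY
  have hY0 : (R projY 0 0).re = 1 / 2 := by rw [h00 _ hY]; simp [projY]
  have hY1 : (R projY 0 1).re = 0 := by rw [h01 _ hY]; simp [projY]
  have hYi : (R projY 0 1).im = -(1 / 2) ∨ (R projY 0 1).im = 1 / 2 := by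
    have h := congrArg Complex.re hRY.normSq_apply_zero_one
    simp only [Complex.mul_re, Complex.conj_re, Complex.conj_im, hY1, Complex.sub_re,
      Complex.one_re, hY0, hRY.im_apply_zero_zero] at h
    have : ((R projY 0 1).im + 1 / 2) * ((R projY 0 1).im - 1 / 2) = 0 := by nlinarith
    rcases mul_eq_zero.1 this with h | h
    · left; linarith
    · right; linarith
  rcases hYi with hi | hi
  · have hRYe : R projY = projY := hRY.eq_of_apply hY (by rw [h00 _ hY])
      (Complex.ext (by rw [h01 _ hY]) (by rw [hi]; simp [projY]; norm_num))
    left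
    intro P hP
    have := htr _ P hY hP
    rw [hRYe, (hR P hP).trace_projY_mul, hP.trace_projY_mul, sub_right_inj] at this
    exact (hR P hP).eq_of_apply hP (h00 P hP) (Complex.ext (h01 P hP) this)
  · have hRYe : R projY = projYᵀ := hRY.eq_of_apply hY.transpose (by rw [h00 _ hY]; rfl)
      (Complex.ext (by rw [hY1]; simp [projY]) (by rw [hi]; simp [projY]))
    right
    intro P hP
    have := htr _ P hY hP
    have e : (projYᵀ * R P).trace = (projY * (R P)ᵀ).trace := by
      rw [← trace_transpose, transpose_mul, transpose_transpose, trace_mul_comm]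
    have hP' := hR P hP
    rw [hRYe, e, hP'.transpose.trace_projY_mul, hP.trace_projY_mul, sub_right_inj,
      transpose_apply, hP'.apply_one_zero, Complex.conj_im] at this
    refine hP'.eq_of_apply hP.transpose (h00 P hP) (Complex.ext ?_ ?_)
    · rw [h01 P hP, transpose_apply, hP.apply_one_zero, Complex.conj_re]
    · rw [transpose_apply, hP.apply_one_zero, Complex.conj_im, ← this, neg_neg]

/-- The unitary `J` with `J A J* = (adj A)ᵀ` for all `A`. -/
def symJ : M2 := !![0, 1; -1, 0]

theorem symJ_mem : symJ ∈ Matrix.unitaryGroup (Fin 2) ℂ := by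
  rw [Matrix.mem_unitaryGroup_iff]
  ext i j; fin_cases i <;> fin_cases j <;>
    simp [symJ, Matrix.mul_apply, star_eq_conjTranspose]

theorem IsRankOneProj.transpose_eq {P : M2} (h : IsRankOneProj P) :
    Pᵀ = symJ * (1 - P) * symJᴴ := by
  have h1 := h.apply_one_one
  ext i j; fin_cases i <;> fin_cases j <;>
    simp only [symJ, Matrix.mul_apply, Fin.sum_univ_two] <;> simp [h1]

/-- Wigner's theorem for `M2`: symmetries of transition probabilities are implemented by a unitary,
possibly after taking orthogonal complements. -/
theorem exists_unitary_of_symmetry {R : M2 → M2}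
    (hR : ∀ P, IsRankOneProj P → IsRankOneProj (R P))
    (htr : ∀ P Q, IsRankOneProj P → IsRankOneProj Q →
      (R P * R Q).trace.re = (P * Q).trace.re) :
    ∃ U ∈ Matrix.unitaryGroup (Fin 2) ℂ, (∀ P, IsRankOneProj P → R P = U * P * Uᴴ) ∨
      ∀ P, IsRankOneProj P → R P = U * (1 - P) * Uᴴ := by
  obtain ⟨V, hV, hVE, hVX⟩ := exists_unitary_pair (hR _ isRankOneProj_projE)
    (hR _ isRankOneProj_projX)
    (by rw [htr _ _ isRankOneProj_projE isRankOneProj_projX, trace_projE_mul_projX]; norm_num)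
  have hv : Vᴴ * V = 1 := Matrix.mem_unitaryGroup_iff'.1 hV
  have hv' : V * Vᴴ = 1 := Matrix.mem_unitaryGroup_iff.1 hV
  have hVs : Vᴴ ∈ Matrix.unitaryGroup (Fin 2) ℂ := Unitary.star_mem hV
  have hinv : ∀ A : M2, Vᴴ * (V * A * Vᴴ) * Vᴴᴴ = A := by
    intro A
    rw [conjTranspose_conjTranspose]
    calc _ = (Vᴴ * V) * A * (Vᴴ * V) := by simp only [mul_assoc]
      _ = A := by rw [hv]; simp
  have hinv' : ∀ A B : M2, Vᴴ * A * Vᴴᴴ = B → A = V * B * Vᴴ := by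
    rintro A B rfl
    rw [conjTranspose_conjTranspose]
    calc A = (V * Vᴴ) * A * (V * Vᴴ) := by rw [hv']; simp
      _ = _ := by simp only [mul_assoc]
  rcases eq_self_or_transpose (R := fun P => Vᴴ * R P * Vᴴᴴ) (fun P hP => (hR P hP).conj hVs)
    (fun P Q hP hQ => by rw [trace_conj_mul_conj hVs, htr P Q hP hQ])
    (by rw [hVE, hinv]) (by rw [hVX, hinv]) with h | h
  · exact ⟨V, hV, Or.inl fun P hP => hinv' _ _ (h P hP)⟩
  · refine ⟨V * symJ, mul_mem hV symJ_mem, Or.inr fun P hP => ?_⟩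
    rw [hinv' _ _ (h P hP), hP.transpose_eq, conjTranspose_mul]
    simp only [mul_assoc]

/-! ### The classification -/

theorem adjugate_eq_trace_sub (A : M2) : A.adjugate = A.trace • (1 : M2) - A := by
  rw [adjugate_fin_two, Matrix.trace_fin_two]
  ext i j; fin_cases i <;> fin_cases j <;> simp

theorem IsRankOneProj.adjugate_spec {P : M2} (h : IsRankOneProj P) (x y : ℝ) :
    (spec P x y).adjugate = spec P y x := by
  rw [adjugate_eq_trace_sub, h.trace_spec, sub_eq_iff_eq_add, spec_add, add_comm y x, spec_self]
  ext i j; simp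

theorem spec_conj {U : M2} (hU : U ∈ Matrix.unitaryGroup (Fin 2) ℂ) (P : M2) (x y : ℝ) :
    spec (U * P * Uᴴ) x y = U * spec P x y * Uᴴ := by
  have h : U * Uᴴ = 1 := Matrix.mem_unitaryGroup_iff.1 hU
  simp only [spec, mul_add, add_mul, mul_smul_comm, smul_mul_assoc, mul_sub, sub_mul, mul_one, h]

/-- Sequential endomorphisms mapping scalars to scalars are a power of the determinant times the
identity, a unitary conjugation, or a unitarily conjugated adjugate. -/
theorem IsSeqEndoOn.scalar_forms {Φ : M2 → M2} (h : IsSeqEndoOn Φ) {s : ℝ}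
    (hs : ∀ x : ℝ, 0 ≤ x → Φ (Real.exp (-x) • (1 : M2)) = Real.exp (-(s * x)) • (1 : M2)) :
    ∃ a : ℝ, 0 ≤ a ∧ ∃ U ∈ Matrix.unitaryGroup (Fin 2) ℂ,
      (∀ A ∈ effects 2, Φ A = (A.det.re ^ a) • (1 : M2)) ∨
      (∀ A ∈ effects 2, Φ A = (A.det.re ^ a) • (U * A * Uᴴ)) ∨
      (∀ A ∈ effects 2, Φ A = (A.det.re ^ a) • (U * A.adjugate * Uᴴ)) := by
  obtain ⟨a, ha, hΦ | ⟨R, hR, htr, hΦ⟩⟩ := h.scalar_cases hs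
  · exact ⟨a, ha, 1, one_mem _, Or.inl hΦ⟩
  obtain ⟨U, hU, hRU⟩ := exists_unitary_of_symmetry hR htr
  refine ⟨a, ha, U, hU, Or.inr ?_⟩
  have hdetc : Continuous fun A : M2 => A.det.re ^ a :=
    (Complex.continuous_re.comp continuous_id.matrix_det).rpow_const fun _ => Or.inr ha
  have hd : ∀ P, IsRankOneProj P → ∀ x y : ℝ, (spec P x y).det.re = x * y := by
    intro P hP x y; rw [hP.det_spec]; norm_cast
  refine hRU.imp (fun hRU A hA => ?_) (fun hRU A hA => ?_)
  · refine eqOn_effects_of_invertible (H := fun A : M2 => A.det.re ^ a • (U * A * Uᴴ))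
      h.continuousOn ?_ ?_ hA
    · exact (hdetc.smul (by fun_prop)).continuousOn
    · intro P hP x y hy hyx hx
      rw [hΦ P hP x y hy hyx hx, hd P hP, hRU P hP, spec_conj hU]
  · refine eqOn_effects_of_invertible (H := fun A : M2 => A.det.re ^ a • (U * A.adjugate * Uᴴ))
      h.continuousOn ?_ ?_ hA
    · exact (hdetc.smul ((continuous_const.mul continuous_id.matrix_adjugate).mul
        continuous_const)).continuousOn
    · intro P hP x y hy hyx hx
      rw [hΦ P hP x y hy hyx hx, hd P hP, hRU P hP, spec_conj hU, spec_compl, hP.adjugate_spec]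

/-- The values of a unital sequential endomorphism at scalars are scalar, or its range commutes
with a rank one projection. -/
theorem IsSeqEndoOn.scalar_or_commuting {Φ : M2 → M2} (h : IsSeqEndoOn Φ) (hone : Φ 1 = 1) :
    (∃ s : ℝ, ∀ x : ℝ, 0 ≤ x → Φ (Real.exp (-x) • (1 : M2)) = Real.exp (-(s * x)) • (1 : M2)) ∨
      ∃ R, IsRankOneProj R ∧ ∀ A ∈ effects 2, R * Φ A = Φ A * R := by
  obtain ⟨R, hR, a, b, -, -, hG⟩ := exists_spec_exp (G := fun x => Φ (Real.exp (-x) • (1 : M2)))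
    (h.continuousOn.comp (by fun_prop) fun x hx => exp_smul_one_mem_effects hx)
    (fun x y hx hy => by
      rw [← h.map_mul (exp_smul_one_mem_effects hx) (exp_smul_one_mem_effects hy)
        (commute_smul_one _ _), neg_add, Real.exp_add, smul_mul_smul_comm, mul_one])
    (by simp [hone]) (fun x hx => h.mapsTo _ (exp_smul_one_mem_effects hx))
  by_cases hab : a = b
  · left
    exact ⟨a, fun x hx => by rw [hG x hx, ← hab, spec_self]⟩
  · right
    refine ⟨R, hR, fun A hA => ?_⟩
    have h1 := h.map_commute (exp_smul_one_mem_effects zero_le_one) hA (commute_smul_one _ A)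
    have h2 : Real.exp (-(a * 1)) ≠ Real.exp (-(b * 1)) := fun he =>
      hab (by have := Real.exp_injective he; linarith)
    refine mul_comm_of_spec h2 ?_
    rw [← hG 1 zero_le_one]
    exact h1

open Classical in
/-- The extension by zero of a self-map of the effects to all matrices. -/
noncomputable def extend (φ : Effect 2 → Effect 2) (A : M2) : M2 :=
  if h : A ∈ effects 2 then (φ ⟨A, h⟩).1 else 0

theorem extend_coe (φ : Effect 2 → Effect 2) (A : Effect 2) : extend φ A.1 = (φ A).1 :=
  dif_pos A.2

theorem isSeqEndoOn_extend {φ : Effect 2 → Effect 2} (hcont : Continuous φ) (hseq : IsSeqEndo φ) :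
    IsSeqEndoOn (extend φ) where
  mapsTo A hA := by
    have := extend_coe φ ⟨A, hA⟩
    rw [this]; exact (φ ⟨A, hA⟩).2
  continuousOn := by
    rw [continuousOn_iff_continuous_domRestrict]
    have : (effects 2).domRestrict (extend φ) = fun A : Effect 2 => (φ A).1 :=
      funext fun A => extend_coe φ A
    rw [this]
    exact continuous_subtype_val.comp hcont
  map_seq A hA B hB := by
    have h1 := congrArg Subtype.val (hseq ⟨A, hA⟩ ⟨B, hB⟩)
    have h2 := extend_coe φ (seqProd ⟨A, hA⟩ ⟨B, hB⟩)
    have h3 := extend_coe φ ⟨A, hA⟩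
    have h4 := extend_coe φ ⟨B, hB⟩
    simp only [seqProd] at h1 h2
    rw [h2, h1, h3, h4]

/-- As `adj A = det A • A⁻¹`, a determinant power times a conjugated adjugate has the form
`FormAdj` for exponent `0` and `FormInv` for positive exponents. -/
theorem formAdj_or_formInv {φ : Effect 2 → Effect 2} {U : M2}
    (hU : U ∈ Matrix.unitaryGroup (Fin 2) ℂ) {a : ℝ} (ha : 0 ≤ a)
    (h : ∀ A : Effect 2, (φ A).1 = (rdet A ^ a) • (U * A.1.adjugate * Uᴴ)) :
    FormAdj φ ∨ FormInv φ := by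
  rcases ha.eq_or_lt with rfl | ha
  · exact Or.inl ⟨U, hU, fun A => by rw [h A, Real.rpow_zero, one_smul]⟩
  · refine Or.inr ⟨U, hU, a + 1, by linarith, fun A => ⟨fun hA => ?_, fun hA => ?_⟩⟩
    · have hdu : IsUnit A.1.det := (isUnit_iff_isUnit_det _).1 hA
      have hdet : A.1.det = (rdet A : ℂ) := det_eq_ofReal_re A.2
      have h0 : rdet A ≠ 0 := fun h0 => hdu.ne_zero (by rw [hdet, h0, Complex.ofReal_zero])
      have hadj : A.1.adjugate = rdet A • A.1⁻¹ := by
        rw [Matrix.inv_def, Ring.inverse_eq_inv', hdet]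
        ext i j
        simp [h0]
      rw [h A, hadj, mul_smul_comm, smul_mul_assoc, smul_smul, Real.rpow_add_one h0]
    · have hd : A.1.det = 0 := by
        by_contra h0
        exact hA ((isUnit_iff_isUnit_det _).2 (isUnit_iff_ne_zero.2 h0))
      have h0 : rdet A = 0 := by rw [rdet, hd, Complex.zero_re]
      rw [h A, h0, Real.zero_rpow ha.ne', zero_smul]

/-- The four forms of a unital continuous sequential endomorphism. -/
theorem unital_forms {φ : Effect 2 → Effect 2} (h : IsSeqEndoOn (extend φ))
    (hone : extend φ 1 = 1) : FormConj φ ∨ FormAdj φ ∨ FormInv φ ∨ FormDiag φ := by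
  rcases h.scalar_or_commuting hone with ⟨s, hs⟩ | ⟨R, hR, hc⟩
  · obtain ⟨a, ha, U, hU, hf | hf | hf⟩ := h.scalar_forms hs
    · refine Or.inr (Or.inr (Or.inr ⟨1, one_mem _, a, a, ha, ha, fun A => ?_⟩))
      change _ = conjDiag 1 (rdet A ^ a) (rdet A ^ a)
      rw [← extend_coe, hf A.1 A.2, ← spec_conjDiag (one_mem _), spec_self]
      rfl
    · exact Or.inl ⟨U, hU, a, ha, fun A => by rw [← extend_coe]; exact hf A.1 A.2⟩
    · have := formAdj_or_formInv (φ := φ) hU ha fun A => by rw [← extend_coe]; exact hf A.1 A.2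
      tauto
  · obtain ⟨c₁, c₂, h1, h2, hf⟩ := h.eq_spec_rpow_det hone hR hc
    obtain ⟨W, hW, rfl⟩ := hR.exists_unitary
    refine Or.inr (Or.inr (Or.inr ⟨W, hW, c₁, c₂, h1, h2, fun A => ?_⟩))
    rw [← extend_coe, hf A.1 A.2, spec_conjDiag hW]
    rfl

end SeqEffect

theorem theorem3 (φ : SeqEffect.Effect 2 → SeqEffect.Effect 2)
    (hcont : Continuous φ) (hseq : SeqEffect.IsSeqEndo φ) :
    (φ 1 = 1 → SeqEffect.FormConj φ ∨ SeqEffect.FormAdj φ ∨ SeqEffect.FormInv φ ∨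
      SeqEffect.FormDiag φ) ∧
    (φ 1 ≠ 1 → SeqEffect.FormDiagZero φ ∨ ∀ A : SeqEffect.Effect 2, (φ A).1 = 0) := by
  have h := SeqEffect.isSeqEndoOn_extend hcont hseq
  have h1 : SeqEffect.extend φ 1 = (φ 1).1 := SeqEffect.extend_coe φ 1
  refine ⟨fun hone => SeqEffect.unital_forms h (by rw [h1, hone]; rfl), fun hone => ?_⟩
  rcases h.map_one_cases with h0 | hp | h0
  · refine Or.inr fun A => ?_
    rw [← SeqEffect.extend_coe, ← (h.map_mul_map_one A.2).1, h0, mul_zero]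
  · obtain ⟨c, hc, hf⟩ := h.eq_rpow_det_smul_of_rankOne hp
    obtain ⟨W, hW, hWe⟩ := hp.exists_unitary
    refine Or.inl ⟨W, hW, c, hc, fun A => ?_⟩
    rw [← SeqEffect.extend_coe, hf A.1 A.2, hWe, SeqEffect.smul_conjDiag, mul_one, mul_zero,
      SeqEffect.conjDiag, Complex.ofReal_zero]
    rfl
  · exact absurd (Subtype.ext (h1.symm.trans h0)) hone
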